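/- For a finite graph $G$ let $m(G)$ be the number of perfect matchings of $G$ and $m'(G)$ the number of all matchings of $G$ (of any size, including the empty matching). (i) There are absolute constants $c,C>0$ and $b_0\in\mathbb N$ such that for all integers $a\ge 1$ and $b\ge b_0$ and every $a$-regular bipartite graph $G$ with two vertex classes of size $b$, $$m(G)\cdot 2^{c\,b/\sqrt a}\le m'(G)\le m(G)\cdot 2^{C\,b/\sqrt a}\qquad\text{and}\qquad \left(\frac ae\right)^b 2^{c\,b/\sqrt a}\le m'(G)\le \left(\frac ae\right)^b 2^{C\,b/\sqrt a}.$$ That is, $m'(G)=m(G)\cdot 2^{\Theta(b/\sqrt a)}=(a/e)^b\cdot 2^{\Theta(b/\sqrt a)}$ as $b\to\infty$, uniformly in $a\ge 1$. (ii) In particular, let $Q_d$ be the $d$-dimensional hypercube graph (vertex set $\{0,1\}^d$, two vertices adjacent when they differ in exactly one coordinate), and put $m(d)=m(Q_d)$, $m'(d)=m'(Q_d)$, $n=2^{d-1}$ and $N=(d/e)^n$. There are absolute constants $c,C>0$ and $d_0$ such that for all integers $d\ge \max(1,d_0)$, $$m(d)\cdot 2^{c\,n/\sqrt d}\le m'(d)\le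 m(d)\cdot 2^{C\,n/\sqrt d}\qquad\text{and}\qquad N\cdot 2^{c\,n/\sqrt d}\le m'(d)\le N\cdot 2^{C\,n/\sqrt d}.$$ That is, $m'(d)=m(d)\cdot 2^{\Theta(n/\sqrt d)}=N\cdot 2^{\Theta(n/\sqrt d)}$ as $d\to\infty$. -/

import Mathlib

/-- The number of perfect matchings of `G`. -/
noncomputable def numPerfectMatchings {V : Type*} (G : SimpleGraph V) : ℕ :=
  Nat.card {M : G.Subgraph // M.IsPerfectMatching}

/-- The number of all matchings of `G` (of any size, the empty one included). In a Mathlib matching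
every vertex of the subgraph lies on exactly one of its edges, so a matching is determined by its
set of pairwise disjoint edges. -/
noncomputable def numMatchings {V : Type*} (G : SimpleGraph V) : ℕ :=
  Nat.card {M : G.Subgraph // M.IsMatching}

/-- The hypercube graph `Q_d` on `{0,1}^d`: two vertices are adjacent when they differ in exactly
one coordinate. -/
def hypercube (d : ℕ) : SimpleGraph (Fin d → Bool) where
  Adj x y := hammingDist x y = 1
  symm := ⟨fun x y h => by rw [hammingDist_comm]; exact h⟩
  loopless := ⟨fun x h => by simp at h⟩

/-!
Write `z = b / √a`. All the quantities compared lie within a factor `exp (O(z))` of `(a / e) ^ b`, and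
the theorem follows from the four explicit estimates

* `(a / e) ^ b ≤ m(G)` (`pow_le_card_relEquivs`),
* `m(G) ≤ (a / e) ^ b * exp z` (`card_relEquivs_le_exp_div_sqrt`),
* `(a / e) ^ b * exp (6 z / 5) ≤ m'(G)` for `b ≥ 2500` (`exp_le_card_relMatchings`),
* `m'(G) ≤ (a / e) ^ b * exp (4 z)` (`card_relMatchings_le_exp`).

The lower bounds rest on van der Waerden's inequality in the form `e ^ (-n) ≤ per A` for doubly
stochastic `A` (`exp_neg_le_permanent`). It is proved by Gurvits' capacity method, where the loss of a
factor `e` per variable comes from bounding a polynomial with negative real roots by an exponential.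
For `m(G)` it is applied to the biadjacency matrix divided by `a`. For `m'(G)` it is applied to the
biadjacency matrix with `t` further rows and columns, whose permanent counts the matchings that leave
`t` vertices of each class unmatched, each `(t !) ^ 2` times; `t` close to `z / 2` is good enough.

The upper bounds rest on Brègman's theorem (`card_relEquivs_le_exp`), proved by Schrijver's
induction. For `m'(G)` one fixes the set `S` of unmatched vertices in the first class and allows each
of them every vertex of the second class: a matching missing exactly `S` then has `(#S)!` completions
to a perfect matching. Summing over `S` by its size `t` gives at most `(a / e) ^ b * exp (z + 1 + log b / 2)`
times `∑ (z ^ t / t !) ^ 2 ≤ exp (2 z)`, and `1 + log b / 2 ≤ √b ≤ z` since `a ≤ b`.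
-/

/-! ### Strictly stable polynomials and capacity -/

open MvPolynomial in
/-- A complex polynomial in `k` variables, homogeneous of degree `k`, with positive values at the
nonzero points of the closed nonnegative orthant and without zeros `z` such that all `Re z i` are
nonnegative and at least one is positive. Allowing some `Re z i` to vanish makes the class closed
under the operation `f ↦ ∂f/∂x₀ |_{x₀ = 0}` without any limit argument. -/
structure IsStrictlyStable {k : ℕ} (f : MvPolynomial (Fin k) ℂ) : Prop where
  isHomogeneous : f.IsHomogeneous k
  eval_ne_zero : ∀ z : Fin k → ℂ, (∀ i, 0 ≤ (z i).re) → (∃ i, 0 < (z i).re) → eval z f ≠ 0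
  eval_pos : ∀ x : Fin k → ℝ, (∀ i, 0 ≤ x i) → x ≠ 0 →
    ∃ r : ℝ, 0 < r ∧ eval (fun i => (x i : ℂ)) f = r

section Univariate

open Polynomial

lemma Multiset.norm_prod_map_one_add_le_exp (m : Multiset ℂ) (u : ℂ → ℝ) (t : ℝ) (ht : 0 ≤ t)
    (hu : ∀ z ∈ m, 0 ≤ u z) :
    ‖(m.map fun z => (1 + t * u z : ℂ)).prod‖ ≤ Real.exp (t * (m.map u).sum) := by
  induction m using Multiset.induction_on with
  | empty => simp
  | cons a m ih =>
    have ha := hu a (by simp)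
    have ih' := ih fun z hz => hu z (by simp [hz])
    simp only [Multiset.map_cons, Multiset.prod_cons, Multiset.sum_cons, norm_mul, mul_add,
      Real.exp_add]
    refine mul_le_mul ?_ ih' (norm_nonneg _) (Real.exp_pos _).le
    have h : (1 + t * u a : ℂ) = ((1 + t * u a : ℝ) : ℂ) := by push_cast; rfl
    rw [h, Complex.norm_real, Real.norm_of_nonneg (by positivity)]
    linarith [Real.add_one_le_exp (t * u a)]

/-- A polynomial with only negative real roots satisfies `F t ≤ F 0 * exp (t * F' 0 / F 0)` for
`t ≥ 0`; if also `c * t ≤ F t`, then the choice `t = F 0 / F' 0` gives `c ≤ e * F' 0`. -/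
lemma Polynomial.le_exp_one_mul_eval_derivative {F : ℂ[X]} {r c : ℝ} (hr : 0 < r)
    (hF : F.eval 0 = r) (hroots : ∀ z ∈ F.roots, ∃ s : ℝ, 0 < s ∧ z = -s)
    (hdeg : F.natDegree ≠ 0) :
    ∃ q : ℝ, 0 < q ∧ F.derivative.eval 0 = q ∧
      ((∀ t : ℝ, 0 < t → c * t ≤ ‖F.eval (t : ℂ)‖) → c ≤ Real.exp 1 * q) := by
  have hs : F.Splits := IsAlgClosed.splits F
  have h0 : F.eval 0 ≠ 0 := by rw [hF]; exact_mod_cast hr.ne'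
  set u : ℂ → ℝ := fun z => (1 / (0 - z)).re with hu
  have hu' : ∀ z ∈ F.roots, (1 / (0 - z) : ℂ) = u z ∧ 0 < u z ∧ z ≠ 0 := by
    intro z hz
    obtain ⟨s, hs, rfl⟩ := hroots z hz
    have : (1 / (0 - -(s : ℂ)) : ℂ) = ((1 / s : ℝ) : ℂ) := by push_cast; ring_nf
    refine ⟨?_, ?_, ?_⟩
    · rw [hu]; simp only [this, Complex.ofReal_re]
    · rw [hu]; simp only [this, Complex.ofReal_re]; positivity
    · simpa using hs.ne'
  have hder := hs.eval_derivative_eq_eval_mul_sum h0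
  have hmap : (F.roots.map fun z => (1 / (0 - z) : ℂ)) = F.roots.map fun z => (u z : ℂ) :=
    Multiset.map_congr rfl fun z hz => (hu' z hz).1
  have hsum : ((F.roots.map u).sum : ℂ) = (F.roots.map fun z => (u z : ℂ)).sum := by
    exact (map_multiset_sum Complex.ofRealHom _).trans (by rw [Multiset.map_map]; rfl)
  set S := (F.roots.map u).sum with hS
  have hcard : F.roots ≠ 0 := by
    intro h
    have := hs.natDegree_eq_card_roots
    rw [h] at this
    exact hdeg (by simpa using this)
  have hSpos : 0 < S := by
    obtain ⟨z, hz⟩ := Multiset.exists_mem_of_ne_zero hcard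
    obtain ⟨m, hm⟩ := Multiset.exists_cons_of_mem hz
    have h1 : 0 ≤ (m.map u).sum := by
      refine Multiset.sum_nonneg fun x hx => ?_
      obtain ⟨y, hy, rfl⟩ := Multiset.mem_map.1 hx
      exact (hu' y (by rw [hm]; simp [hy])).2.1.le
    rw [hS, hm, Multiset.map_cons, Multiset.sum_cons]
    linarith [(hu' z hz).2.1]
  refine ⟨r * S, by positivity, ?_, fun hc => ?_⟩
  · rw [hder, hmap, ← hsum, hF]; push_cast; rfl
  · have hev : ∀ t : ℝ, F.eval (t : ℂ) = r * (F.roots.map fun z => (1 + t * u z : ℂ)).prod := by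
      intro t
      rw [← hF, hs.eval_eq_prod_roots, hs.eval_eq_prod_roots, mul_assoc, ← Multiset.prod_map_mul]
      congr 2
      refine Multiset.map_congr rfl fun z hz => ?_
      rw [← (hu' z hz).1]
      have := (hu' z hz).2.2
      have : (0 - z) ≠ 0 := by simpa using this
      field_simp
      ring
    have h1 := hc (1 / S) (by positivity)
    rw [hev, norm_mul, Complex.norm_real, Real.norm_of_nonneg hr.le] at h1
    have h2 := Multiset.norm_prod_map_one_add_le_exp F.roots u (1 / S) (by positivity)
      fun z hz => (hu' z hz).2.1.le
    rw [← hS, one_div_mul_cancel hSpos.ne'] at h2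
    have h3 : c * (1 / S) ≤ r * Real.exp 1 := h1.trans (by gcongr)
    rw [mul_one_div, div_le_iff₀ hSpos] at h3
    linarith

end Univariate

section Capacity

open MvPolynomial

lemma MvPolynomial.IsHomogeneous.eval_smul' {k n : ℕ} {f : MvPolynomial (Fin k) ℂ}
    (hf : f.IsHomogeneous n) (w : ℂ) (z : Fin k → ℂ) :
    eval (fun i => w * z i) f = w ^ n * eval z f := by
  rw [eval_eq', eval_eq', Finset.mul_sum]
  refine Finset.sum_congr rfl fun d hd => ?_
  have hdeg := hf.degree_eq_sum_deg_support hd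
  simp only [mul_pow, Finset.prod_mul_distrib, Finset.prod_pow_eq_pow_sum]
  have : ∑ i, d i = n := by
    rw [hdeg]
    exact (Finset.sum_subset (Finset.subset_univ _) (by simp)).symm
  rw [this]; ring

lemma MvPolynomial.IsHomogeneous.eval_zero {k n : ℕ} {f : MvPolynomial (Fin k) ℂ}
    (hf : f.IsHomogeneous n) (hn : n ≠ 0) : eval 0 f = 0 := by
  have := hf.eval_smul' 0 0
  simpa [hn, Pi.zero_def] using this

namespace IsStrictlyStable

variable {k : ℕ} {f : MvPolynomial (Fin (k + 1)) ℂ}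

/-- By homogeneity `f` has full degree in the first variable: the coefficient of `x₀ ^ (k + 1)` is
the value of `f` at the first unit vector. -/
lemma coeff_top_ne_zero (hf : IsStrictlyStable f) (z : Fin k → ℂ) :
    eval z ((finSuccEquiv ℂ k f).coeff (k + 1)) ≠ 0 := by
  have h1 := hf.eval_ne_zero (Fin.cons 1 0) (fun i => by
    refine Fin.cases ?_ (fun j => ?_) i <;> simp) ⟨0, by simp⟩
  rw [eval_eq_eval_mv_eval'] at h1
  have hz : ∀ i, i ≠ k + 1 → (Polynomial.map (eval (0 : Fin k → ℂ)) (finSuccEquiv ℂ k f)).coeff i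
      = 0 := by
    intro i hi
    rw [Polynomial.coeff_map]
    rcases lt_or_gt_of_ne hi with h | h
    · exact (hf.isHomogeneous.finSuccEquiv_coeff_isHomogeneous i (k + 1 - i)
        (by omega)).eval_zero (by omega)
    · have : (finSuccEquiv ℂ k f).coeff i = 0 := by
        ext m
        rw [finSuccEquiv_coeff_coeff, coeff_zero]
        refine hf.isHomogeneous.coeff_eq_zero fun h' => ?_
        have : (Finsupp.cons i m) 0 ≤ (Finsupp.cons i m).degree := Finsupp.le_degree 0 _
        rw [Finsupp.cons_zero] at this
        omega
      rw [this, map_zero]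
  have hc : (finSuccEquiv ℂ k f).coeff (k + 1) = C (coeff 0 ((finSuccEquiv ℂ k f).coeff (k + 1))) :=
    totalDegree_eq_zero_iff_eq_C.1 ((totalDegree_zero_iff_isHomogeneous _).2
      (hf.isHomogeneous.finSuccEquiv_coeff_isHomogeneous (k + 1) 0 (by omega)))
  rw [Polynomial.eval_eq_sum, Polynomial.sum_def] at h1
  intro h0
  apply h1
  refine Finset.sum_eq_zero fun i _ => ?_
  by_cases hi : i = k + 1
  · rw [hi, Polynomial.coeff_map]
    rw [hc, eval_C] at h0 ⊢
    rw [h0, zero_mul]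
  · rw [hz i hi, zero_mul]

lemma natDegree_ne_zero (hf : IsStrictlyStable f) (z : Fin k → ℂ) :
    (Polynomial.map (eval z) (finSuccEquiv ℂ k f)).natDegree ≠ 0 := by
  have : k + 1 ≤ (Polynomial.map (eval z) (finSuccEquiv ℂ k f)).natDegree := by
    refine Polynomial.le_natDegree_of_ne_zero ?_
    rw [Polynomial.coeff_map]
    exact hf.coeff_top_ne_zero z
  omega

lemma eval_cons_ne_zero (hf : IsStrictlyStable f) {z : Fin k → ℂ} (hz : ∀ i, 0 ≤ (z i).re)
    (hz0 : ∃ i, 0 < (z i).re) {t : ℂ} (ht : 0 ≤ t.re) :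
    (Polynomial.map (eval z) (finSuccEquiv ℂ k f)).eval t ≠ 0 := by
  rw [← eval_eq_eval_mv_eval']
  obtain ⟨j, hj⟩ := hz0
  refine hf.eval_ne_zero _ (fun i => ?_) ⟨j.succ, by simpa using hj⟩
  refine Fin.cases ?_ (fun j => ?_) i
  · simpa using ht
  · simpa using hz j

lemma eval_derivative (z : Fin k → ℂ) :
    (Polynomial.map (eval z) (finSuccEquiv ℂ k f)).derivative.eval 0 =
      eval z ((finSuccEquiv ℂ k f).coeff 1) := by
  rw [← Polynomial.coeff_zero_eq_eval_zero, Polynomial.coeff_derivative, Polynomial.coeff_map]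
  simp

/-- At a nonnegative real point of the last variables, all roots in the first variable are negative
reals: a root `t` off the nonpositive axis could be rotated, together with the point and by half its
argument, into the right half-space. -/
lemma roots_neg (hf : IsStrictlyStable f) {x : Fin k → ℝ} (hx : ∀ i, 0 ≤ x i) (hx0 : x ≠ 0) :
    ∀ t ∈ (Polynomial.map (eval fun i => (x i : ℂ)) (finSuccEquiv ℂ k f)).roots,
      ∃ s : ℝ, 0 < s ∧ t = -s := by
  intro t ht
  have hroot := Polynomial.isRoot_of_mem_roots ht
  rw [Polynomial.IsRoot.def, ← eval_eq_eval_mv_eval'] at hroot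
  obtain ⟨i₀, hi₀⟩ : ∃ i, 0 < x i := by
    by_contra! h
    exact hx0 (funext fun i => le_antisymm (h i) (hx i))
  by_contra hcon
  have hslit : t ∈ Complex.slitPlane := by
    by_contra h
    rw [Complex.mem_slitPlane_iff, not_or, not_lt, not_not] at h
    have ht' : t = (t.re : ℂ) := Complex.ext rfl (by simp [h.2])
    rcases h.1.lt_or_eq with h1 | h1
    · exact hcon ⟨-t.re, by linarith, by rw [ht']; simp⟩
    · refine hf.eval_cons_ne_zero (z := fun i => (x i : ℂ)) (fun i => by simpa using hx i)
        ⟨i₀, by simpa using hi₀⟩ (t := t) h1.ge ?_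
      rw [← eval_eq_eval_mv_eval']; exact hroot
  have harg := Complex.mem_slitPlane_iff_arg.1 hslit
  set θ := t.arg / 2 with hθ
  have hcos : 0 < Real.cos θ := by
    refine Real.cos_pos_of_mem_Ioo ⟨?_, ?_⟩
    · have := Complex.neg_pi_lt_arg t; rw [hθ]; linarith
    · have := lt_of_le_of_ne (Complex.arg_le_pi t) harg.1; rw [hθ]; linarith
  set w := Complex.exp ((-θ : ℝ) * Complex.I) with hw
  have hwre : 0 < w.re := by
    rw [hw, Complex.exp_ofReal_mul_I_re, Real.cos_neg]; exact hcos
  have hwt : w * t = ‖t‖ * Complex.exp ((θ : ℝ) * Complex.I) := by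
    conv_lhs => rw [← Complex.norm_mul_exp_arg_mul_I t]
    rw [hw, mul_left_comm, ← Complex.exp_add]
    congr 2
    rw [hθ]; push_cast; ring
  have hwtre : 0 ≤ (w * t).re := by
    rw [hwt, Complex.re_ofReal_mul, Complex.exp_ofReal_mul_I_re]
    positivity
  have key := hf.isHomogeneous.eval_smul' w (Fin.cons t fun i => (x i : ℂ))
  rw [hroot, mul_zero] at key
  refine hf.eval_ne_zero _ (fun i => ?_) ⟨i₀.succ, by simpa using mul_pos hwre hi₀⟩ key
  refine Fin.cases ?_ (fun j => ?_) i
  · simpa using hwtre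
  · simpa using mul_nonneg hwre.le (hx j)

lemma exists_eval_zero (hf : IsStrictlyStable f) {x : Fin k → ℝ} (hx : ∀ i, 0 ≤ x i)
    (hx0 : x ≠ 0) {t : ℝ} (ht : 0 ≤ t) : ∃ r : ℝ, 0 < r ∧
      (Polynomial.map (eval fun i => (x i : ℂ)) (finSuccEquiv ℂ k f)).eval (t : ℂ) = r := by
  obtain ⟨r, hr, h⟩ := hf.eval_pos (Fin.cons t x) (fun i => by
    refine Fin.cases ?_ (fun j => ?_) i
    · simpa using ht
    · simpa using hx j) (fun h => hx0 (by ext j; simpa using congrFun h j.succ))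
  refine ⟨r, hr, ?_⟩
  rw [← h, ← eval_eq_eval_mv_eval']
  congr 2
  ext i
  refine Fin.cases ?_ (fun j => ?_) i <;> simp

/-- The nonvanishing of `∂f/∂x₀ |_{x₀ = 0}` is the Gauss–Lucas argument: the logarithmic derivative
at `0` of a polynomial with all its roots in the open left half-plane has positive real part. -/
lemma coeff_one (hf : IsStrictlyStable f) : IsStrictlyStable ((finSuccEquiv ℂ k f).coeff 1) where
  isHomogeneous := hf.isHomogeneous.finSuccEquiv_coeff_isHomogeneous 1 k (by omega)
  eval_ne_zero z hz hz0 := by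
    rw [← eval_derivative]
    set F := Polynomial.map (eval z) (finSuccEquiv ℂ k f) with hF
    have hs : F.Splits := IsAlgClosed.splits F
    have h0 : F.eval 0 ≠ 0 := hf.eval_cons_ne_zero hz hz0 (by simp)
    have hpos : ∀ w ∈ F.roots, 0 < (1 / (0 - w)).re := by
      intro w hw
      have hwre : w.re < 0 := by
        by_contra h
        exact hf.eval_cons_ne_zero hz hz0 (not_lt.1 h) (Polynomial.isRoot_of_mem_roots hw)
      rw [zero_sub, one_div, Complex.inv_re]
      refine div_pos (by simpa using hwre) (Complex.normSq_pos.2 ?_)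
      intro h
      rw [neg_eq_zero] at h
      simp [h] at hwre
    rw [hs.eval_derivative_eq_eval_mul_sum h0]
    refine mul_ne_zero h0 fun h => ?_
    have hcard : F.roots ≠ 0 := by
      intro h
      have := hs.natDegree_eq_card_roots
      rw [h] at this
      exact hf.natDegree_ne_zero z (by simpa using this)
    have hre : ((F.roots.map fun w => (1 / (0 - w)).re).sum : ℝ) = 0 := by
      have := congrArg Complex.reAddGroupHom h
      rw [map_multiset_sum, Multiset.map_map] at this
      simpa using this
    obtain ⟨w, hw⟩ := Multiset.exists_mem_of_ne_zero hcard
    obtain ⟨m, hm⟩ := Multiset.exists_cons_of_mem hw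
    have h1 : 0 ≤ (m.map fun w => (1 / (0 - w)).re).sum := by
      refine Multiset.sum_nonneg fun x hx => ?_
      obtain ⟨y, hy, rfl⟩ := Multiset.mem_map.1 hx
      exact (hpos y (by rw [hm]; simp [hy])).le
    rw [hm, Multiset.map_cons, Multiset.sum_cons] at hre
    linarith [hpos w hw]
  eval_pos x hx hx0 := by
    obtain ⟨r, hr, h⟩ := hf.exists_eval_zero hx hx0 le_rfl
    obtain ⟨q, hq, h', -⟩ := Polynomial.le_exp_one_mul_eval_derivative (c := 0) hr
      (by simpa using h) (hf.roots_neg hx hx0) (hf.natDegree_ne_zero _)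
    exact ⟨q, hq, by rw [← eval_derivative, h']⟩

/-- Gurvits' capacity inequality, with the constant `e` for each variable instead of the sharp
`(j / (j - 1)) ^ (j - 1)`: if `c * ∏ x i ≤ f x` on the positive orthant, then `c` is at most
`e ^ k` times the coefficient of `∏ x i` in `f`. -/
theorem le_exp_mul_coeff : ∀ {k : ℕ} {f : MvPolynomial (Fin (k + 1)) ℂ}, IsStrictlyStable f →
    ∀ {c : ℝ}, (∀ x : Fin (k + 1) → ℝ, (∀ i, 0 < x i) →
      c * ∏ i, x i ≤ ‖eval (fun i => (x i : ℂ)) f‖) →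
    c ≤ Real.exp k * ‖coeff (Finsupp.equivFunOnFinite.symm fun _ => 1) f‖ := by
  intro k
  induction k with
  | zero =>
    intro f hf c hc
    have h := hc (fun _ => 1) (fun _ => one_pos)
    have he : eval (fun _ : Fin (0 + 1) => ((1 : ℝ) : ℂ)) f =
        coeff (Finsupp.equivFunOnFinite.symm fun _ => 1) f := by
      rw [eval_eq']
      simp only [Complex.ofReal_one, one_pow, Finset.prod_const_one, mul_one]
      refine Finset.sum_eq_single (M := ℂ) (Finsupp.equivFunOnFinite.symm fun _ => 1)
        (fun m hm hne => ?_) (fun hm => by simpa using hm)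
      exfalso
      apply hne
      have hdeg := hf.isHomogeneous.degree_eq_sum_deg_support hm
      rw [Finset.sum_subset (Finset.subset_univ _) (by simp)] at hdeg
      ext i
      fin_cases i
      simpa using hdeg.symm
    rw [he] at h
    simpa using h
  | succ k ih =>
    intro f hf c hc
    have h1 := ih hf.coeff_one (c := c / Real.exp 1) fun x hx => ?_
    · rw [finSuccEquiv_coeff_coeff] at h1
      have hm : Finsupp.cons 1 (Finsupp.equivFunOnFinite.symm fun _ : Fin (k + 1) => 1) =
          Finsupp.equivFunOnFinite.symm fun _ : Fin (k + 1 + 1) => 1 := by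
        ext i
        refine Fin.cases ?_ (fun j => ?_) i <;> simp
      rw [hm, div_le_iff₀ (Real.exp_pos 1)] at h1
      rw [Nat.cast_succ, Real.exp_add]
      linarith
    · have hx0 : x ≠ 0 := fun h => (hx 0).ne' (congrFun h 0)
      obtain ⟨r, hr, h⟩ := hf.exists_eval_zero (fun i => (hx i).le) hx0 le_rfl
      obtain ⟨q, hq, h', hbound⟩ := Polynomial.le_exp_one_mul_eval_derivative (c := c * ∏ i, x i) hr
        (by simpa using h) (hf.roots_neg (fun i => (hx i).le) hx0) (hf.natDegree_ne_zero _)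
      rw [← eval_derivative, h', Complex.norm_real, Real.norm_of_nonneg hq.le, div_mul_eq_mul_div,
        div_le_iff₀ (Real.exp_pos 1), mul_comm q]
      refine hbound fun t ht => ?_
      have h2 := hc (Fin.cons t x) (fun i => by
        refine Fin.cases ?_ (fun j => ?_) i
        · simpa using ht
        · simpa using hx j)
      rw [Fin.prod_cons] at h2
      have h3 : (fun i => (((Fin.cons t x : Fin (k + 1 + 1) → ℝ) i : ℝ) : ℂ)) =
          Fin.cons (t : ℂ) (fun i => (x i : ℂ)) := by
        ext i
        refine Fin.cases ?_ (fun j => ?_) i <;> simp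
      rw [h3, eval_eq_eval_mv_eval'] at h2
      linarith

end IsStrictlyStable

end Capacity

/-! ### The van der Waerden bound -/

open MvPolynomial in
/-- The product of the linear forms given by the rows of a matrix; the coefficient of the monomial
in which every variable occurs once is the permanent. -/
noncomputable def prodLinearForms {ι : Type*} [Fintype ι] {k : ℕ} (A : ι → Fin k → ℝ) :
    MvPolynomial (Fin k) ℂ :=
  ∏ i, ∑ j, C (A i j : ℂ) * X j

section VanDerWaerden

open MvPolynomial

lemma eval_prodLinearForms {ι : Type*} [Fintype ι] {k : ℕ} (A : ι → Fin k → ℝ) (z : Fin k → ℂ) :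
    eval z (prodLinearForms A) = ∏ i, ∑ j, (A i j : ℂ) * z j := by
  simp [prodLinearForms, map_prod, map_sum]

lemma isStrictlyStable_prodLinearForms {ι : Type*} [Fintype ι] {k : ℕ} {A : ι → Fin k → ℝ}
    (hι : Fintype.card ι = k) (hA : ∀ i j, 0 < A i j) :
    IsStrictlyStable (prodLinearForms A) where
  isHomogeneous := by
    have : (prodLinearForms A).IsHomogeneous (∑ _i : ι, 1) := by
      refine IsHomogeneous.prod _ _ _ fun i _ => IsHomogeneous.sum _ _ _ fun j _ => ?_
      simpa using (isHomogeneous_C (Fin k) (A i j : ℂ)).mul (isHomogeneous_X ℂ j)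
    simpa [hι] using this
  eval_ne_zero z hz hz0 := by
    rw [eval_prodLinearForms]
    refine Finset.prod_ne_zero_iff.2 fun i _ h => ?_
    have hre := congrArg Complex.re h
    rw [Complex.re_sum] at hre
    simp only [Complex.re_ofReal_mul, Complex.zero_re] at hre
    obtain ⟨j, hj⟩ := hz0
    have : 0 < ∑ j, A i j * (z j).re := Finset.sum_pos'
      (fun j _ => mul_nonneg (hA i j).le (hz j)) ⟨j, Finset.mem_univ _, mul_pos (hA i j) hj⟩
    linarith
  eval_pos x hx hx0 := by
    refine ⟨∏ i, ∑ j, A i j * x j, Finset.prod_pos fun i _ => ?_, ?_⟩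
    · obtain ⟨j, hj⟩ := Function.ne_iff.1 hx0
      exact Finset.sum_pos' (fun j _ => mul_nonneg (hA i j).le (hx j))
        ⟨j, Finset.mem_univ _, mul_pos (hA i j) (lt_of_le_of_ne (hx j) (Ne.symm hj))⟩
    · rw [eval_prodLinearForms]; push_cast; rfl

lemma coeff_prodLinearForms {ι : Type*} [Fintype ι] [DecidableEq ι] {k : ℕ} (A : ι → Fin k → ℝ) :
    coeff (Finsupp.equivFunOnFinite.symm fun _ => 1) (prodLinearForms A) =
      ((∑ σ : ι ≃ Fin k, ∏ i, A i (σ i) : ℝ) : ℂ) := by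
  classical
  have hmon : ∀ φ : ι → Fin k, (∏ i, (C (A i (φ i) : ℂ) * X (φ i)) : MvPolynomial (Fin k) ℂ) =
      monomial (∑ i, Finsupp.single (φ i) 1) ((∏ i, A i (φ i) : ℝ) : ℂ) := by
    intro φ
    have h : ∀ i, (C (A i (φ i) : ℂ) * X (φ i) : MvPolynomial (Fin k) ℂ) =
        monomial (Finsupp.single (φ i) 1) (A i (φ i) : ℂ) := fun i => C_mul_X_eq_monomial
    simp only [h]
    rw [← mul_one ((∏ i, A i (φ i) : ℝ) : ℂ), ← C_mul_monomial, monomial_sum_one,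
      Complex.ofReal_prod, map_prod, ← Finset.prod_mul_distrib]
    exact Finset.prod_congr rfl fun i _ => by rw [C_mul_monomial, mul_one]
  have hiff : ∀ φ : ι → Fin k, (∑ i, Finsupp.single (φ i) 1 : Fin k →₀ ℕ) =
      Finsupp.equivFunOnFinite.symm (fun _ => 1) ↔ Function.Bijective φ := by
    intro φ
    have hval : ∀ j, (∑ i, Finsupp.single (φ i) 1 : Fin k →₀ ℕ) j =
        (Finset.univ.filter fun i => φ i = j).card := by
      intro j
      rw [Finsupp.finsetSum_apply, Finset.card_filter]
      exact Finset.sum_congr rfl fun i _ => by rw [Finsupp.single_apply]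
    rw [Function.bijective_iff_existsUnique, Finsupp.ext_iff]
    refine forall_congr' fun j => ?_
    rw [hval, show (Finsupp.equivFunOnFinite.symm fun _ : Fin k => 1) j = 1 from rfl,
      Finset.card_eq_one]
    constructor
    · rintro ⟨i, hi⟩
      refine ⟨i, ?_, fun i' hi' => ?_⟩
      · simpa using (Finset.ext_iff.1 hi i).2 (by simp)
      · simpa using (Finset.ext_iff.1 hi i').1 (by simpa using hi')
    · rintro ⟨i, hi, hu⟩
      refine ⟨i, Finset.ext fun i' => ?_⟩
      simp only [Finset.mem_filter, Finset.mem_univ, true_and, Finset.mem_singleton]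
      exact ⟨hu i', fun h => h ▸ hi⟩
  rw [prodLinearForms, Finset.prod_univ_sum, coeff_sum]
  simp only [hmon, coeff_monomial, hiff]
  rw [← Finset.sum_filter, Complex.ofReal_sum]
  refine Finset.sum_bij' (fun φ hφ => Equiv.ofBijective φ (Finset.mem_filter.1 hφ).2)
    (fun σ _ => σ) (by simp) (fun σ _ => by simp) (fun φ _ => rfl)
    (fun σ _ => by ext; rfl) (fun φ _ => rfl)

/-- The weighted inequality between arithmetic and geometric means, in every row: a doubly
stochastic matrix has capacity at least `1`. -/
lemma prod_le_prod_sum_of_doublyStochastic {ι κ : Type*} [Fintype ι] [Fintype κ] {A : ι → κ → ℝ}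
    (hA : ∀ i j, 0 ≤ A i j) (hrow : ∀ i, ∑ j, A i j = 1) (hcol : ∀ j, ∑ i, A i j = 1)
    {x : κ → ℝ} (hx : ∀ j, 0 < x j) : ∏ j, x j ≤ ∏ i, ∑ j, A i j * x j := by
  calc ∏ j, x j = ∏ j, ∏ i, x j ^ A i j := by
        refine Finset.prod_congr rfl fun j _ => ?_
        rw [← Real.rpow_sum_of_pos (hx j), hcol, Real.rpow_one]
    _ = ∏ i, ∏ j, x j ^ A i j := Finset.prod_comm
    _ ≤ ∏ i, ∑ j, A i j * x j := by
        refine Finset.prod_le_prod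
          (fun i _ => Finset.prod_nonneg fun j _ => Real.rpow_nonneg (hx j).le _) fun i _ => ?_
        exact Real.geom_mean_le_arith_mean_weighted _ _ _ (fun j _ => hA i j) (hrow i)
          (fun j _ => (hx j).le)

lemma one_le_exp_mul_permanent_of_pos {ι : Type*} [Fintype ι] [DecidableEq ι] {k : ℕ}
    (hι : Fintype.card ι = k + 1) {A : ι → Fin (k + 1) → ℝ} (hA : ∀ i j, 0 < A i j)
    (hrow : ∀ i, ∑ j, A i j = 1) (hcol : ∀ j, ∑ i, A i j = 1) :
    1 ≤ Real.exp k * ∑ σ : ι ≃ Fin (k + 1), ∏ i, A i (σ i) := by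
  have h := (isStrictlyStable_prodLinearForms hι hA).le_exp_mul_coeff (c := 1) fun x hx => ?_
  · rw [coeff_prodLinearForms A, Complex.norm_real, Real.norm_of_nonneg] at h
    · exact h
    · exact Finset.sum_nonneg fun σ _ => Finset.prod_nonneg fun i _ => (hA _ _).le
  · rw [eval_prodLinearForms, one_mul]
    have h1 := prod_le_prod_sum_of_doublyStochastic (fun i j => (hA i j).le) hrow hcol hx
    have h2 : (∏ i, ∑ j, (A i j : ℂ) * (x j : ℂ)) = ((∏ i, ∑ j, A i j * x j : ℝ) : ℂ) := by
      push_cast; rfl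
    rw [h2, Complex.norm_real]
    exact h1.trans (le_abs_self _)

/-- The van der Waerden bound for doubly stochastic matrices, with the constant `e ^ (-n)`. It
follows from the case of positive entries by mixing in a small multiple of the constant matrix
`1 / n`. -/
theorem exp_neg_le_permanent {ι κ : Type*} [Fintype ι] [DecidableEq ι] [Fintype κ] [DecidableEq κ]
    {n : ℕ} (hι : Fintype.card ι = n) (hκ : Fintype.card κ = n) {A : ι → κ → ℝ}
    (hA : ∀ i j, 0 ≤ A i j) (hrow : ∀ i, ∑ j, A i j = 1) (hcol : ∀ j, ∑ i, A i j = 1) :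
    Real.exp (-n) ≤ ∑ σ : ι ≃ κ, ∏ i, A i (σ i) := by
  cases n with
  | zero =>
    have := Fintype.card_eq_zero_iff.1 hι
    have := Fintype.card_eq_zero_iff.1 hκ
    have : 0 < Fintype.card (ι ≃ κ) := Fintype.card_pos_iff.2 ⟨Equiv.equivOfIsEmpty ι κ⟩
    simpa using Nat.one_le_iff_ne_zero.2 this.ne'
  | succ k =>
    have e : κ ≃ Fin (k + 1) := Fintype.equivFinOfCardEq hκ
    set B : ℝ → ι → Fin (k + 1) → ℝ := fun ε i j => (1 - ε) * A i (e.symm j) + ε / (k + 1) with hB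
    have hpos : ∀ ε ∈ Set.Ioo (0 : ℝ) 1,
        Real.exp (-(k + 1 : ℕ)) ≤ ∑ σ : ι ≃ Fin (k + 1), ∏ i, B ε i (σ i) := by
      rintro ε ⟨h0, h1⟩
      have hk : (0 : ℝ) < k + 1 := by positivity
      have h := one_le_exp_mul_permanent_of_pos (A := B ε) hι
        (fun i j => add_pos_of_nonneg_of_pos (mul_nonneg (by linarith) (hA _ _)) (by positivity))
        (fun i => by
          simp only [hB]
          rw [Finset.sum_add_distrib, ← Finset.mul_sum, e.symm.sum_comp, hrow]
          simp
          field_simp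
          ring)
        (fun j => by
          simp only [hB]
          rw [Finset.sum_add_distrib, ← Finset.mul_sum, hcol]
          simp [hι]
          field_simp
          ring)
      have h2 : Real.exp (-(k + 1 : ℕ)) ≤ Real.exp (-k) := by
        apply Real.exp_le_exp.2; push_cast; linarith
      refine h2.trans ?_
      rw [Real.exp_neg, inv_le_iff_one_le_mul₀ (Real.exp_pos _)]
      linarith
    have hcont : Continuous fun ε => ∑ σ : ι ≃ Fin (k + 1), ∏ i, B ε i (σ i) := by
      simp only [hB]; fun_prop
    have hlim : Real.exp (-(k + 1 : ℕ)) ≤ ∑ σ : ι ≃ Fin (k + 1), ∏ i, B 0 i (σ i) := by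
      refine ge_of_tendsto (x := nhdsWithin (0 : ℝ) (Set.Ioi 0))
        ((hcont.tendsto 0).mono_left nhdsWithin_le_nhds) ?_
      filter_upwards [Ioo_mem_nhdsGT (zero_lt_one' ℝ)] with ε hε using hpos ε hε
    refine hlim.trans (le_of_eq ?_)
    refine Fintype.sum_equiv (Equiv.equivCongr (Equiv.refl ι) e.symm) _ _ fun σ => ?_
    simp [hB]

end VanDerWaerden

/-! ### Brègman's theorem -/

section Bregman

open Finset
open scoped Nat

/-- The bijections between the two classes of a bipartite relation that are contained in the
relation, that is, the perfect matchings of the bipartite graph. -/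
noncomputable def relEquivs {α β : Type*} [Fintype α] [Fintype β] (r : α → β → Prop) :
    Finset (α ≃ β) := by
  classical exact univ.filter fun σ => ∀ x, r x (σ x)

/-- The number of elements to which `x` is related. -/
noncomputable def relDegree {α β : Type*} [Fintype β] (r : α → β → Prop) (x : α) : ℕ := by
  classical exact (univ.filter (r x)).card

/-- The logarithm of the geometric mean of `1, …, n`; its value at `0` is `0`. -/
noncomputable def logFactorialMean (n : ℕ) : ℝ := Real.log n ! / n

lemma mul_logFactorialMean (n : ℕ) : n * logFactorialMean n = Real.log n ! := by
  rcases eq_or_ne n 0 with rfl | h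
  · simp
  · have : (n : ℝ) ≠ 0 := by exact_mod_cast h
    rw [logFactorialMean]; field_simp

variable {α β : Type*} [Fintype β]

lemma relDegree_eq_card {r : α → β → Prop} [∀ x, DecidablePred (r x)] (x : α) :
    relDegree r x = #{y | r x y} := by
  unfold relDegree; congr

lemma relDegree_pos {r : α → β → Prop} {x : α} {y : β} (h : r x y) : 0 < relDegree r x := by
  classical
  rw [relDegree_eq_card]
  exact card_pos.2 ⟨y, by simpa using h⟩

lemma relDegree_subtype_ne [DecidableEq β] (r : α → β → Prop) (y : β) (x : α) [Decidable (r x y)] :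
    relDegree (fun (x : α) (z : {z : β // z ≠ y}) => r x z) x =
      relDegree r x - if r x y then 1 else 0 := by
  classical
  have h1 : #{z : {z : β // z ≠ y} | r x z} = #(({z | r x z} : Finset β).erase y) := by
    rw [← card_map (Function.Embedding.subtype fun z => z ≠ y)]
    congr 1
    ext z
    simp [and_comm]
  rw [relDegree_eq_card, relDegree_eq_card, h1]
  split_ifs with h
  · exact card_erase_of_mem (by simpa using h)
  · rw [erase_eq_of_notMem (by simpa using h), Nat.sub_zero]

variable [Fintype α]

@[simp] lemma mem_relEquivs {r : α → β → Prop} {σ : α ≃ β} :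
    σ ∈ relEquivs r ↔ ∀ x, r x (σ x) := by
  simp [relEquivs]

lemma card_filter_apply_eq_le [DecidableEq α] [DecidableEq β] (r : α → β → Prop) (x : α) (y : β) :
    #{σ ∈ relEquivs r | σ x = y} ≤
      #(relEquivs fun (a : {a : α // a ≠ x}) (b : {b : β // b ≠ y}) => r a b) := by
  classical
  have hne : ∀ σ : α ≃ β, σ x = y → ∀ a, a ≠ x ↔ σ a ≠ y := fun σ h a => by
    rw [← h, σ.injective.ne_iff]
  refine card_le_card_of_injOn
    (fun σ => if h : σ x = y then σ.subtypeEquiv (hne σ h) else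
      (Fintype.equivOfCardEq (by simp [Fintype.card_congr σ]))) ?_ ?_
  · intro σ hσ
    rw [mem_coe, mem_filter, mem_relEquivs] at hσ
    simp only [hσ.2, dif_pos, mem_coe, mem_relEquivs]
    exact fun a => hσ.1 a
  · intro σ hσ τ hτ h
    rw [mem_coe, mem_filter] at hσ hτ
    simp only [hσ.2, hτ.2, dif_pos] at h
    ext a
    by_cases ha : a = x
    · rw [ha, hσ.2, hτ.2]
    · exact congrArg Subtype.val (congrArg (fun e => e ⟨a, ha⟩) h)

/-- The entropy of the value at `x` is at most the logarithm of the number of possible values. -/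
lemma card_mul_log_card_le [DecidableEq β] (r : α → β → Prop) (x : α) :
    (#(relEquivs r) : ℝ) * Real.log #(relEquivs r) ≤
      ∑ σ ∈ relEquivs r,
        (Real.log (relDegree r x) + Real.log #{τ ∈ relEquivs r | τ x = σ x}) := by
  classical
  set S := relEquivs r with hS
  rcases S.eq_empty_or_nonempty with h0 | hne
  · simp [h0]
  obtain ⟨σ₀, hσ₀⟩ := hne
  have hN : (0 : ℝ) < #S := by exact_mod_cast card_pos.2 ⟨σ₀, hσ₀⟩
  have hd : (0 : ℝ) < relDegree r x := by exact_mod_cast relDegree_pos (mem_relEquivs.1 hσ₀ x)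
  have hpos : ∀ σ ∈ S, (0 : ℝ) < #{τ ∈ S | τ x = σ x} := fun σ hσ => by
    exact_mod_cast card_pos.2 ⟨σ, by simp [hσ]⟩
  have hle : ∀ σ ∈ S, Real.log #S - (Real.log (relDegree r x) + Real.log #{τ ∈ S | τ x = σ x}) ≤
      #S / relDegree r x * (1 / #{τ ∈ S | τ x = σ x}) - 1 := by
    intro σ hσ
    have h := hpos σ hσ
    have := Real.log_le_sub_one_of_pos (x := #S / relDegree r x * (1 / #{τ ∈ S | τ x = σ x}))
      (by positivity)
    rw [Real.log_mul (by positivity) (by positivity), Real.log_div hN.ne' hd.ne',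
      one_div, Real.log_inv] at this
    rw [one_div]
    linarith
  have hsum := sum_le_sum hle
  have hcount : ∑ σ ∈ S, (1 / #{τ ∈ S | τ x = σ x} : ℝ) ≤ relDegree r x := by
    rw [← sum_fiberwise_of_maps_to (s := S) (t := ({y | r x y} : Finset β)) (g := fun σ => σ x)
      (fun σ hσ => by simpa using mem_relEquivs.1 hσ x), relDegree_eq_card, card_eq_sum_ones,
      Nat.cast_sum]
    refine sum_le_sum fun y _ => ?_
    rw [sum_congr rfl (g := fun _ => (1 / #{τ ∈ S | τ x = y} : ℝ))
      fun σ hσ => by rw [(mem_filter.1 hσ).2]]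
    rw [sum_const, nsmul_eq_mul, Nat.cast_one]
    rw [mul_one_div]
    exact div_self_le_one _
  rw [sum_sub_distrib, sum_sub_distrib, ← mul_sum, sum_const, sum_const, nsmul_eq_mul,
    nsmul_eq_mul, mul_one] at hsum
  have : (#S : ℝ) / relDegree r x * ∑ σ ∈ S, (1 / #{τ ∈ S | τ x = σ x} : ℝ) ≤ #S := by
    calc _ ≤ (#S : ℝ) / relDegree r x * relDegree r x := by gcongr
      _ = #S := by field_simp
  linarith

/-- Removing row `x` and column `σ x` lowers the degree of a row `j ≠ x` by one if `r j (σ x)`, which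
holds for `relDegree r j - 1` of the rows `x ≠ j`. Hence the Brègman exponents of row `j` in all these
minors, together with `log (relDegree r j)`, add up to `Fintype.card α` times its exponent in `r`. -/
lemma sum_logFactorialMean_sub [DecidableEq α] {r : α → β → Prop} [∀ x, DecidablePred (r x)]
    {σ : α ≃ β} (hσ : ∀ x, r x (σ x)) (j : α) :
    Real.log (relDegree r j) +
      ∑ x ∈ univ.erase j, logFactorialMean (relDegree r j - if r j (σ x) then 1 else 0) =
    Fintype.card α * logFactorialMean (relDegree r j) := by
  classical
  set d := relDegree r j with hd
  have hd0 : 0 < d := relDegree_pos (hσ j)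
  have h1 := add_sum_erase univ
    (fun x => logFactorialMean (d - if r j (σ x) then 1 else 0)) (mem_univ j)
  have h2 : ∑ x, logFactorialMean (d - if r j (σ x) then 1 else 0) =
      d * logFactorialMean (d - 1) + (Fintype.card α - d) * logFactorialMean d := by
    rw [σ.sum_comp fun y => logFactorialMean (d - if r j y then 1 else 0)]
    have h3 : ∀ y, logFactorialMean (d - if r j y then 1 else 0) =
        logFactorialMean d + if r j y then logFactorialMean (d - 1) - logFactorialMean d else 0 := by
      intro y; split_ifs <;> simp
    simp only [h3]
    rw [sum_add_distrib, ← sum_filter, sum_const, sum_const, card_univ, ← relDegree_eq_card,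
      ← hd, Fintype.card_congr σ, nsmul_eq_mul, nsmul_eq_mul]
    ring
  rw [h2] at h1
  simp only [hσ j, if_true] at h1
  have h4 : Real.log d + ((d : ℝ) - 1) * logFactorialMean (d - 1) = d * logFactorialMean d := by
    obtain ⟨e, he⟩ : ∃ e, d = e + 1 := ⟨d - 1, by omega⟩
    rw [mul_logFactorialMean, he, Nat.factorial_succ, Nat.add_sub_cancel]
    push_cast
    rw [add_sub_cancel_right, mul_logFactorialMean, Real.log_mul (by positivity) (by positivity)]
  linarith

/-- Brègman's theorem, by Schrijver's induction on the number of rows. -/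
theorem card_relEquivs_le_exp : ∀ (n : ℕ) {α : Type*} {β : Type*} [Fintype α] [Fintype β]
    (r : α → β → Prop), Fintype.card α = n →
    (#(relEquivs r) : ℝ) ≤ Real.exp (∑ x, logFactorialMean (relDegree r x)) := by
  classical
  intro n
  induction n with
  | zero =>
    intro α β _ _ r hα
    have := Fintype.card_eq_zero_iff.1 hα
    have : #(relEquivs r) ≤ 1 := card_le_one.2 fun σ _ τ _ => by
      ext a; exact isEmptyElim a
    simpa using this
  | succ n ih =>
    intro α β _ _ r hα
    set S := relEquivs r with hS
    rcases S.eq_empty_or_nonempty with h0 | hne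
    · rw [h0]; simp; positivity
    have hN : (0 : ℝ) < #S := by exact_mod_cast card_pos.2 hne
    rw [← Real.log_le_iff_le_exp hN]
    have hminor : ∀ σ ∈ S, ∀ x, Real.log #{τ ∈ S | τ x = σ x} ≤
        ∑ j ∈ univ.erase x, logFactorialMean (relDegree r j - if r j (σ x) then 1 else 0) := by
      intro σ hσ x
      have hpos : (0 : ℝ) < #{τ ∈ S | τ x = σ x} := by
        exact_mod_cast card_pos.2 ⟨σ, by simp [hσ]⟩
      rw [Real.log_le_iff_le_exp hpos]
      have h1 : (#{τ ∈ S | τ x = σ x} : ℝ) ≤ _ := Nat.cast_le.2 (card_filter_apply_eq_le r x (σ x))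
      refine h1.trans ((ih _ (by simp [Fintype.card_subtype_compl, hα])).trans (le_of_eq ?_))
      congr 1
      rw [sum_subtype (univ.erase x) (p := fun a => a ≠ x) (by simp)]
      exact sum_congr rfl fun j _ => by rw [← relDegree_subtype_ne]; rfl
    have hkey : ((n + 1 : ℕ) : ℝ) * (#S * Real.log #S) ≤
        #S * ((n + 1 : ℕ) * ∑ j, logFactorialMean (relDegree r j)) := by
      calc ((n + 1 : ℕ) : ℝ) * (#S * Real.log #S)
          = ∑ _x : α, (#S : ℝ) * Real.log #S := by
            rw [sum_const, card_univ, hα, nsmul_eq_mul]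
        _ ≤ ∑ x, ∑ σ ∈ S, (Real.log (relDegree r x) + Real.log #{τ ∈ S | τ x = σ x}) :=
            sum_le_sum fun x _ => card_mul_log_card_le r x
        _ = ∑ σ ∈ S, ∑ x, (Real.log (relDegree r x) + Real.log #{τ ∈ S | τ x = σ x}) := sum_comm
        _ ≤ ∑ σ ∈ S, ∑ j, ((n + 1 : ℕ) : ℝ) * logFactorialMean (relDegree r j) := by
            refine sum_le_sum fun σ hσ => ?_
            rw [sum_add_distrib]
            have h2 : ∑ x, ∑ j ∈ univ.erase x,
                logFactorialMean (relDegree r j - if r j (σ x) then 1 else 0) =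
                ∑ j, ∑ x ∈ univ.erase j,
                logFactorialMean (relDegree r j - if r j (σ x) then 1 else 0) :=
              sum_comm' (by simp [eq_comm])
            calc _ ≤ _ := add_le_add_right (sum_le_sum fun x _ => hminor σ hσ x) _
              _ = _ := by
                rw [h2, ← sum_add_distrib]
                refine sum_congr rfl fun j _ => ?_
                rw [sum_logFactorialMean_sub (mem_relEquivs.1 hσ), hα]
        _ = _ := by rw [sum_const, nsmul_eq_mul, ← mul_sum]
    have hn : (0 : ℝ) < (n + 1 : ℕ) := by positivity
    have h5 : (((n + 1 : ℕ) : ℝ) * #S) * Real.log #S ≤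
        ((n + 1 : ℕ) * #S) * ∑ j, logFactorialMean (relDegree r j) := by linarith
    exact le_of_mul_le_mul_left h5 (by positivity)

end Bregman

/-! ### Counting matchings of a bipartite relation -/

section Matchings

open Finset
open scoped Nat

variable {α β : Type*} [Fintype α] [Fintype β]

/-- The matchings contained in a bipartite relation, as partial functions: an unmatched `x` has the
value `none`. -/
noncomputable def relMatchings (r : α → β → Prop) : Finset (α → Option β) := by
  classical exact univ.filter fun f =>
    (∀ x y, f x = some y → r x y) ∧ ∀ x x' y, f x = some y → f x' = some y → x = x'

@[simp] lemma mem_relMatchings {r : α → β → Prop} {f : α → Option β} :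
    f ∈ relMatchings r ↔
      (∀ x y, f x = some y → r x y) ∧ ∀ x x' y, f x = some y → f x' = some y → x = x' := by
  simp [relMatchings]

lemma exists_equiv_extending_matching {r : α → β → Prop}
    (hcard : Fintype.card α = Fintype.card β) {f : α → Option β} (hf : f ∈ relMatchings r) :
    ∃ σ : α ≃ β, ∀ x y, f x = some y → σ x = y := by
  classical
  rw [mem_relMatchings] at hf
  by_cases hβ : Nonempty β
  · obtain ⟨y₀⟩ := hβ
    obtain ⟨g, hg⟩ := Finset.exists_equiv_extend_of_card_eq (t := (univ : Finset β))
      (s := {x | f x ≠ none}) (f := fun x => (f x).getD y₀) (by simpa using hcard)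
      (subset_univ _) (fun x hx x' hx' h => by
        simp only [coe_filter, mem_univ, true_and, Set.mem_ofPred_eq,
          Option.ne_none_iff_exists'] at hx hx'
        obtain ⟨y, hy⟩ := hx
        obtain ⟨y', hy'⟩ := hx'
        simp only [hy, hy', Option.getD_some] at h
        exact hf.2 x x' y hy (h ▸ hy'))
    refine ⟨g.trans (Equiv.subtypeUnivEquiv fun _ => mem_univ _), fun x y hxy => ?_⟩
    have := hg x (by simp [hxy])
    simpa [hxy] using this
  · have : IsEmpty β := not_nonempty_iff.1 hβ
    exact ⟨Fintype.equivOfCardEq hcard, fun x y => isEmptyElim y⟩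

/-- A matching that leaves exactly the set `S` of rows unmatched has `(#S)!` completions to a
perfect matching once the rows in `S` are allowed every column. -/
lemma card_matchings_mul_factorial_le [DecidableEq α] [DecidableEq β] {r : α → β → Prop}
    (hcard : Fintype.card α = Fintype.card β) (S : Finset α) :
    #{f ∈ relMatchings r | ({x | f x = none} : Finset α) = S} * (#S)! ≤
      #(relEquivs fun x y => x ∈ S ∨ r x y) := by
  classical
  have hext : ∀ f : α → Option β, ∃ σ : α ≃ β, f ∈ relMatchings r →
      ∀ x y, f x = some y → σ x = y := fun f => by
    by_cases hf : f ∈ relMatchings r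
    · obtain ⟨σ, hσ⟩ := exists_equiv_extending_matching hcard hf
      exact ⟨σ, fun _ => hσ⟩
    · exact ⟨Fintype.equivOfCardEq hcard, fun h => absurd h hf⟩
  choose σ hσ using hext
  have hval : ∀ f ∈ ({f ∈ relMatchings r | ({x | f x = none} : Finset α) = S} : Finset _),
      ∀ π : Equiv.Perm S, ∀ x, f x = if x ∈ S then none else
        some (((Equiv.Perm.ofSubtype π : Equiv.Perm α).trans (σ f)) x) := by
    intro f hf π x
    rw [mem_filter] at hf
    have hmem : f x = none ↔ x ∈ S := by rw [← hf.2]; simp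
    split_ifs with hx
    · exact hmem.2 hx
    · obtain ⟨y, hy⟩ := Option.ne_none_iff_exists'.1 fun h => hx (hmem.1 h)
      rw [Equiv.trans_apply, Equiv.Perm.ofSubtype_apply_of_not_mem π hx, hy, hσ f hf.1 x y hy]
  have hperm : (#S)! = #(univ : Finset (Equiv.Perm S)) := by
    rw [card_univ, Fintype.card_perm, Fintype.card_coe]
  rw [hperm, ← card_product]
  refine card_le_card_of_injOn
    (fun q => (Equiv.Perm.ofSubtype q.2 : Equiv.Perm α).trans (σ q.1)) ?_ ?_
  · rintro ⟨f, π⟩ hq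
    rw [mem_coe, mem_product] at hq
    rw [mem_coe, mem_relEquivs]
    intro x
    by_cases hx : x ∈ S
    · exact Or.inl hx
    · have h := hval f hq.1 π x
      rw [if_neg hx] at h
      exact Or.inr ((mem_relMatchings.1 (mem_filter.1 hq.1).1).1 x _ h)
  · rintro ⟨f, π⟩ hq ⟨f', π'⟩ hq' h
    rw [mem_coe, mem_product] at hq hq'
    simp only at h
    have hff : f = f' := by
      ext1 x
      rw [hval f hq.1 π x, hval f' hq'.1 π' x, h]
    subst hff
    refine Prod.ext rfl (Equiv.Perm.ofSubtype_injective ?_)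
    ext x
    exact (σ f).injective (congrArg (fun e => e x) h)

lemma card_matchings_le_exp [DecidableEq α] [DecidableEq β] {r : α → β → Prop} {a b : ℕ}
    (hα : Fintype.card α = b) (hβ : Fintype.card β = b) (hr : ∀ x, relDegree r x = a)
    (S : Finset α) :
    (#{f ∈ relMatchings r | ({x | f x = none} : Finset α) = S} : ℝ) ≤
      Real.exp ((b - #S) * logFactorialMean a + #S * logFactorialMean b) / (#S)! := by
  classical
  have h1 := card_matchings_mul_factorial_le (r := r) (hα.trans hβ.symm) S
  have h2 := card_relEquivs_le_exp b (fun x y => x ∈ S ∨ r x y) hα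
  have h3 : ∀ x, logFactorialMean (relDegree (fun x y => x ∈ S ∨ r x y) x) =
      logFactorialMean a + if x ∈ S then logFactorialMean b - logFactorialMean a else 0 := by
    intro x
    split_ifs with hx
    · rw [relDegree_eq_card]
      simp [hx, hβ]
    · rw [relDegree_eq_card, ← hr x, relDegree_eq_card]
      simp [hx]
  have h4 : ∑ x, logFactorialMean (relDegree (fun x y => x ∈ S ∨ r x y) x) =
      (b - #S) * logFactorialMean a + #S * logFactorialMean b := by
    simp only [h3]
    rw [sum_add_distrib, ← sum_filter, sum_const, sum_const, card_univ, hα, nsmul_eq_mul,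
      nsmul_eq_mul, filter_mem_eq_inter, univ_inter]
    ring
  rw [h4] at h2
  rw [le_div_iff₀ (by positivity)]
  exact le_trans (by exact_mod_cast h1) h2

theorem card_relMatchings_le_sum {r : α → β → Prop} {a b : ℕ}
    (hα : Fintype.card α = b) (hβ : Fintype.card β = b) (hr : ∀ x, relDegree r x = a) :
    (#(relMatchings r) : ℝ) ≤ ∑ t ∈ range (b + 1), (b.choose t : ℝ) *
      (Real.exp ((b - t) * logFactorialMean a + t * logFactorialMean b) / t !) := by
  classical
  have h1 := card_eq_sum_card_fiberwise (s := relMatchings r) (t := (univ : Finset α).powerset)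
    (f := fun f => ({x | f x = none} : Finset α)) (fun f _ => by simp)
  rw [h1, Nat.cast_sum]
  refine (sum_le_sum fun S _ => card_matchings_le_exp hα hβ hr S).trans (le_of_eq ?_)
  rw [sum_powerset_apply_card
    fun t => Real.exp ((b - t) * logFactorialMean a + t * logFactorialMean b) / t !]
  rw [card_univ, hα]
  exact sum_congr rfl fun t _ => by rw [nsmul_eq_mul]

/-- The relation `r` bordered by `γ` on both sides: each new element is related to all old elements
of the other side and to no new one. -/
def borderedRel (r : α → β → Prop) (γ : Type*) : α ⊕ γ → β ⊕ γ → Prop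
  | .inl x, .inl y => r x y
  | .inl _, .inr _ => True
  | .inr _, .inl _ => True
  | .inr _, .inr _ => False

/-- The matching between the old elements contained in a perfect matching of a bordered relation. -/
def innerMatching {α β γ : Type*} (σ : α ⊕ γ ≃ β ⊕ γ) (x : α) : Option β :=
  (σ (.inl x)).getLeft?

lemma innerMatching_eq_some {α β γ : Type*} {σ : α ⊕ γ ≃ β ⊕ γ} {x : α} {y : β} :
    innerMatching σ x = some y ↔ σ (.inl x) = .inl y := by
  rw [innerMatching, Sum.getLeft?_eq_some_iff]

lemma innerMatching_mem {γ : Type*} [Fintype γ] {r : α → β → Prop} {σ : α ⊕ γ ≃ β ⊕ γ}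
    (hσ : σ ∈ relEquivs (borderedRel r γ)) : innerMatching σ ∈ relMatchings r := by
  simp only [mem_relMatchings, innerMatching_eq_some]
  refine ⟨fun x y h => ?_, fun x x' y h h' => ?_⟩
  · have := mem_relEquivs.1 hσ (.inl x)
    rw [h] at this
    exact this
  · exact Sum.inl_injective (σ.injective (h.trans h'.symm))

lemma exists_perm_border {α β γ : Type*} [Finite γ] {σ τ : α ⊕ γ ≃ β ⊕ γ}
    (hσ : ∀ i j, σ (.inr i) ≠ .inr j)
    (h : ∀ x y, σ (.inl x) = .inl y ↔ τ (.inl x) = .inl y) :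
    ∃ π : Equiv.Perm γ, ∀ i, σ (.inr i) = τ (.inr (π i)) := by
  have hex : ∀ i, ∃ j, σ (.inr i) = τ (.inr j) := by
    intro i
    rcases hy : σ (.inr i) with y | j
    · rcases hx : τ.symm (.inl y) with x | j
      · have := (h x y).2 (by rw [← hx, Equiv.apply_symm_apply])
        simpa using σ.injective (this.trans hy.symm)
      · exact ⟨j, by rw [← hx, Equiv.apply_symm_apply]⟩
    · exact absurd hy (hσ i j)
  choose p hp using hex
  have hinj : Function.Injective p := fun i i' hii => by
    have := (hp i).trans ((congrArg (fun j => τ (.inr j)) hii).trans (hp i').symm)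
    simpa using σ.injective this
  exact ⟨Equiv.ofBijective p (Finite.injective_iff_bijective.1 hinj), hp⟩

lemma card_relEquivs_bordered_le (r : α → β → Prop) (t : ℕ) :
    #(relEquivs (borderedRel r (Fin t))) ≤ (t ! * t !) * #(relMatchings r) := by
  classical
  refine card_le_mul_card_image_of_maps_to (f := innerMatching)
    (fun σ hσ => innerMatching_mem hσ) _ fun f _ => ?_
  rcases ({σ ∈ relEquivs (borderedRel r (Fin t)) | innerMatching σ = f} :
    Finset _).eq_empty_or_nonempty with h0 | ⟨τ, hτ⟩
  · rw [h0]; simp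
  have hne : ∀ σ ∈ relEquivs (borderedRel r (Fin t)), ∀ i j, σ (.inr i) ≠ .inr j := by
    intro σ hσ i j h
    have := mem_relEquivs.1 hσ (.inr i)
    rw [h] at this
    exact this
  have hinner : ∀ σ : α ⊕ Fin t ≃ β ⊕ Fin t, innerMatching σ = f →
      ∀ x y, σ (.inl x) = .inl y ↔ f x = some y := fun σ h x y => by
    rw [← h, innerMatching_eq_some]
  rw [mem_filter] at hτ
  have hex : ∀ σ : α ⊕ Fin t ≃ β ⊕ Fin t, ∃ π : Equiv.Perm (Fin t) × Equiv.Perm (Fin t),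
      σ ∈ relEquivs (borderedRel r (Fin t)) → innerMatching σ = f →
      (∀ i, σ (.inr i) = τ (.inr (π.1 i))) ∧
        ∀ i, σ.symm (.inr i) = τ.symm (.inr (π.2 i)) := by
    intro σ
    by_cases h : σ ∈ relEquivs (borderedRel r (Fin t)) ∧ innerMatching σ = f
    · obtain ⟨π, hπ⟩ := exists_perm_border (hne σ h.1)
        (fun x y => (hinner σ h.2 x y).trans (hinner τ hτ.2 x y).symm)
      obtain ⟨π', hπ'⟩ := exists_perm_border (σ := σ.symm) (τ := τ.symm)
        (fun i j hij => hne σ h.1 j i (by rw [← hij, Equiv.apply_symm_apply]))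
        (fun y x => by
          rw [Equiv.symm_apply_eq, Equiv.symm_apply_eq, eq_comm, hinner σ h.2, ← hinner τ hτ.2]
          exact eq_comm)
      exact ⟨(π, π'), fun _ _ => ⟨hπ, hπ'⟩⟩
    · exact ⟨1, fun h1 h2 => absurd ⟨h1, h2⟩ h⟩
  choose π hπ using hex
  have hcard : t ! * t ! = #(univ : Finset (Equiv.Perm (Fin t) × Equiv.Perm (Fin t))) := by
    rw [card_univ, Fintype.card_prod, Fintype.card_perm, Fintype.card_fin]
  rw [hcard]
  refine card_le_card_of_injOn π (fun _ _ => by simp) fun σ hσ ρ hρ h => ?_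
  rw [mem_coe, mem_filter] at hσ hρ
  have h1 := hπ σ hσ.1 hσ.2
  have h2 := hπ ρ hρ.1 hρ.2
  rw [h] at h1
  ext z
  rcases z with x | i
  · rcases hz : σ (.inl x) with y | j
    · exact ((hinner ρ hρ.2 x y).2 ((hinner σ hσ.2 x y).1 hz)).symm
    · have h3 := (h1.2 j).trans (h2.2 j).symm
      rw [← hz, Equiv.symm_apply_apply, hz] at h3
      rw [h3, Equiv.apply_symm_apply]
  · rw [h1.1, h2.1]

open Classical in
/-- The weights on a bordered relation: `p` between old elements, `q` on the border. -/
noncomputable def borderedWeight (r : α → β → Prop) (γ : Type*) (p q : ℝ) : α ⊕ γ → β ⊕ γ → ℝ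
  | .inl x, .inl y => if r x y then p else 0
  | .inl _, .inr _ => q
  | .inr _, .inl _ => q
  | .inr _, .inr _ => 0

lemma prod_borderedWeight (r : α → β → Prop) {t b : ℕ} (hα : Fintype.card α = b) (p q : ℝ)
    {σ : α ⊕ Fin t ≃ β ⊕ Fin t} (hσ : σ ∈ relEquivs (borderedRel r (Fin t))) :
    ∏ z, borderedWeight r (Fin t) p q z (σ z) = p ^ (b - t) * q ^ (2 * t) := by
  classical
  have hr := mem_relEquivs.1 hσ
  have h1 : ∀ x, borderedWeight r (Fin t) p q (.inl x) (σ (.inl x)) =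
      if (σ (.inl x)).isRight then q else p := by
    intro x
    have := hr (.inl x)
    rcases hy : σ (.inl x) with y | j
    · rw [hy] at this
      have hxy : r x y := this
      simp [borderedWeight, hxy]
    · simp [borderedWeight]
  have h2 : ∀ i, borderedWeight r (Fin t) p q (.inr i) (σ (.inr i)) = q := by
    intro i
    have := hr (.inr i)
    rcases hy : σ (.inr i) with y | j
    · rfl
    · rw [hy] at this
      exact this.elim
  have hcount : #{x : α | (σ (.inl x)).isRight} = t := by
    have h3 : #{x : α | (σ (.inl x)).isRight} = #(univ : Finset (Fin t)) := by
      refine card_bij' (s := {x : α | (σ (.inl x)).isRight}) (t := (univ : Finset (Fin t)))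
        (fun x hx => (σ (.inl x)).getRight (by simpa using hx))
        (fun j _ => (σ.symm (.inr j)).getLeft ?_) (by simp) ?_ ?_ ?_
      · rcases hz : σ.symm (.inr j) with x | i
        · rfl
        · have := hr (.inr i)
          rw [← hz, Equiv.apply_symm_apply, hz] at this
          exact this.elim
      · intro j hj; simp
      · intro x hx; simp
      · intro j hj; simp
    rw [h3, card_univ, Fintype.card_fin]
  have hcount' : #{x : α | ¬ (σ (.inl x)).isRight} = b - t := by
    have := card_filter_add_card_filter_not (s := (univ : Finset α))
      (fun x => (σ (.inl x)).isRight = true)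
    rw [hcount, card_univ, hα] at this
    omega
  rw [Fintype.prod_sum_type]
  simp only [h1, h2]
  rw [prod_ite, prod_const, prod_const, prod_const, card_univ, Fintype.card_fin, hcount, hcount']
  ring

/-- The van der Waerden bound for the bordered matrix, in which the perfect matchings correspond to
the matchings of `r` that leave `t` elements of each side unmatched. -/
theorem exp_neg_le_card_relMatchings {r : α → β → Prop} {a b : ℕ} (ha : 0 < a) (hb : 0 < b)
    (hα : Fintype.card α = b) (hβ : Fintype.card β = b) (hr : ∀ x, relDegree r x = a)
    (hr' : ∀ y, relDegree (fun y x => r x y) y = a) {t : ℕ} (ht : t ≤ b) :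
    Real.exp (-(b + t)) ≤
      (#(relMatchings r) : ℝ) * (t ! * t !) * (((1 - t / b) / a) ^ (b - t) * (1 / b) ^ (2 * t)) := by
  classical
  have ha' : (0 : ℝ) < a := by exact_mod_cast ha
  have hb' : (0 : ℝ) < b := by exact_mod_cast hb
  have ht' : (t : ℝ) / b ≤ 1 := by rw [div_le_one hb']; exact_mod_cast ht
  set p : ℝ := (1 - t / b) / a with hp
  set q : ℝ := 1 / b with hq
  have hp0 : 0 ≤ p := div_nonneg (by linarith) ha'.le
  have hq0 : 0 ≤ q := by positivity
  have hpq : a * p + t * q = 1 := by rw [hp, hq]; field_simp; ring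
  have hbq : b * q = 1 := by rw [hq]; field_simp
  have hvdw := exp_neg_le_permanent (n := b + t) (A := borderedWeight r (Fin t) p q)
    (by simp [hα]) (by simp [hβ])
    (by
      rintro (x | i) (y | j)
      · rw [borderedWeight]; split_ifs <;> simp [hp0]
      · exact hq0
      · exact hq0
      · exact le_rfl)
    (by
      rintro (x | i)
      · rw [Fintype.sum_sum_type]
        simp only [borderedWeight]
        rw [← sum_filter, sum_const, ← relDegree_eq_card, hr]
        simpa using hpq
      · rw [Fintype.sum_sum_type]
        simpa [borderedWeight, hβ] using hbq)
    (by
      rintro (y | i)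
      · rw [Fintype.sum_sum_type]
        simp only [borderedWeight]
        rw [← sum_filter, sum_const, ← relDegree_eq_card (r := fun y x => r x y), hr']
        simpa using hpq
      · rw [Fintype.sum_sum_type]
        simpa [borderedWeight, hα] using hbq)
  have hsum : ∑ σ : α ⊕ Fin t ≃ β ⊕ Fin t, ∏ z, borderedWeight r (Fin t) p q z (σ z) =
      #(relEquivs (borderedRel r (Fin t))) * (p ^ (b - t) * q ^ (2 * t)) := by
    rw [← sum_subset (subset_univ (relEquivs (borderedRel r (Fin t)))),
      sum_congr rfl fun σ hσ => prod_borderedWeight r hα p q hσ, sum_const, nsmul_eq_mul]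
    intro σ _ hσ
    rw [mem_relEquivs] at hσ
    push Not at hσ
    obtain ⟨z, hz⟩ := hσ
    refine prod_eq_zero (mem_univ z) ?_
    generalize σ z = w at hz
    rcases z with x | i <;> rcases w with y | j
    · exact if_neg hz
    · exact (hz trivial).elim
    · exact (hz trivial).elim
    · rfl
  rw [hsum] at hvdw
  push_cast at hvdw
  refine hvdw.trans ?_
  have hle : (#(relEquivs (borderedRel r (Fin t))) : ℝ) ≤ (t ! * t !) * #(relMatchings r) := by
    exact_mod_cast card_relEquivs_bordered_le r t
  rw [mul_comm (#(relMatchings r) : ℝ)]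
  gcongr

/-- Every regular bipartite relation has at least `(a / e) ^ b` perfect matchings. -/
theorem pow_le_card_relEquivs {r : α → β → Prop} {a b : ℕ} (ha : 0 < a)
    (hα : Fintype.card α = b) (hβ : Fintype.card β = b) (hr : ∀ x, relDegree r x = a)
    (hr' : ∀ y, relDegree (fun y x => r x y) y = a) :
    ((a : ℝ) / Real.exp 1) ^ b ≤ #(relEquivs r) := by
  classical
  have ha' : (0 : ℝ) < a := by exact_mod_cast ha
  have hvdw := exp_neg_le_permanent (n := b) (A := fun x y => if r x y then (1 / a : ℝ) else 0)
    hα hβ (fun x y => by positivity)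
    (fun x => by
      rw [← sum_filter, sum_const, ← relDegree_eq_card, hr, nsmul_eq_mul]; field_simp)
    (fun y => by
      rw [← sum_filter, sum_const, ← relDegree_eq_card (r := fun y x => r x y), hr', nsmul_eq_mul]
      field_simp)
  have hsum : ∑ σ : α ≃ β, ∏ x, (if r x (σ x) then (1 / a : ℝ) else 0) =
      #(relEquivs r) * (1 / a) ^ b := by
    rw [← sum_subset (subset_univ (relEquivs r)), sum_congr rfl (g := fun _ => (1 / a : ℝ) ^ b),
      sum_const, nsmul_eq_mul]
    · intro σ hσ
      rw [prod_congr rfl fun x _ => if_pos (mem_relEquivs.1 hσ x), prod_const, card_univ, hα]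
    · intro σ _ hσ
      rw [mem_relEquivs] at hσ
      push Not at hσ
      obtain ⟨x, hx⟩ := hσ
      exact prod_eq_zero (mem_univ x) (if_neg hx)
  rw [hsum, Real.exp_neg, one_div, inv_pow, ← div_eq_mul_inv, le_div_iff₀ (by positivity)] at hvdw
  rw [div_pow, ← Real.exp_nat_mul, mul_one, div_eq_inv_mul]
  exact hvdw

end Matchings

/-! ### Factorial estimates and the exponents -/

section Estimates

open Finset
open scoped Nat

lemma log_factorial_le {n : ℕ} (hn : 0 < n) :
    Real.log n ! ≤ 1 + Real.log n / 2 + n * Real.log n - n := by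
  obtain ⟨k, rfl⟩ : ∃ k, n = k + 1 := ⟨n - 1, by omega⟩
  have h := Stirling.stirlingSeq'_antitone (Nat.zero_le k)
  simp only [Function.comp, Nat.succ_eq_add_one, zero_add, Stirling.stirlingSeq_one] at h
  have h1 := Real.log_le_log (Stirling.stirlingSeq'_pos k) h
  rw [Stirling.log_stirlingSeq_formula, Real.log_div (Real.exp_ne_zero _) (by positivity),
    Real.log_exp, Real.log_sqrt (by norm_num), Real.log_mul (by norm_num) (by positivity),
    Real.log_div (by positivity) (Real.exp_ne_zero _), Real.log_exp] at h1
  linarith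

lemma le_log_factorial {n : ℕ} (hn : 0 < n) : n * Real.log n - n ≤ Real.log n ! := by
  have h := Stirling.le_log_factorial_stirling hn.ne'
  have h1 : 0 ≤ Real.log n := Real.log_natCast_nonneg n
  have h2 : 0 ≤ Real.log (2 * Real.pi) := Real.log_nonneg (by linarith [Real.pi_gt_three])
  linarith

lemma one_add_half_log_le_sqrt {x : ℝ} (hx : 0 < x) : 1 + Real.log x / 2 ≤ √x := by
  rw [← Real.log_sqrt hx.le]
  linarith [Real.log_le_sub_one_of_pos (Real.sqrt_pos.2 hx)]

lemma mul_logFactorialMean_le {a : ℕ} (ha : 0 < a) (b : ℕ) :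
    b * logFactorialMean a ≤ b * (Real.log a - 1) + b / √a := by
  have ha' : (0 : ℝ) < a := by exact_mod_cast ha
  have hs : 0 < √(a : ℝ) := Real.sqrt_pos.2 ha'
  have h1 := log_factorial_le ha
  have h2 := one_add_half_log_le_sqrt ha'
  have h3 : logFactorialMean a ≤ Real.log a - 1 + 1 / √a := by
    rw [logFactorialMean, div_le_iff₀ ha']
    have h4 : 1 / √(a : ℝ) * a = √a := by
      rw [one_div_mul_eq_div, Real.div_sqrt]
    rw [add_mul, h4]
    linarith
  calc b * logFactorialMean a ≤ b * (Real.log a - 1 + 1 / √a) := by gcongr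
    _ = _ := by ring

lemma sqrt_le_div_sqrt {a b : ℕ} (ha : 0 < a) (hab : a ≤ b) : √(b : ℝ) ≤ b / √a := by
  have ha' : (0 : ℝ) < a := by exact_mod_cast ha
  rw [le_div_iff₀ (Real.sqrt_pos.2 ha')]
  calc √(b : ℝ) * √a ≤ √b * √b := by gcongr
    _ = b := Real.mul_self_sqrt (by positivity)

lemma sum_sq_pow_div_factorial_le {z : ℝ} (hz : 0 ≤ z) (n : ℕ) :
    ∑ t ∈ range n, (z ^ t / t !) ^ 2 ≤ Real.exp (2 * z) := by
  calc ∑ t ∈ range n, (z ^ t / t !) ^ 2 ≤ (∑ t ∈ range n, z ^ t / t !) ^ 2 :=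
        sum_sq_le_sq_sum_of_nonneg fun _ _ => by positivity
    _ ≤ Real.exp z ^ 2 := by
        have := Real.sum_le_exp_of_nonneg hz n
        have h0 : 0 ≤ ∑ t ∈ range n, z ^ t / t ! := sum_nonneg fun _ _ => by positivity
        gcongr
    _ = Real.exp (2 * z) := by rw [← Real.exp_nat_mul]; norm_num

lemma choose_mul_exp_le {a b t : ℕ} (ha : 0 < a) (hab : a ≤ b) (ht : t ≤ b) :
    (b.choose t : ℝ) *
      (Real.exp ((b - t) * logFactorialMean a + t * logFactorialMean b) / t !) ≤
    Real.exp (b * logFactorialMean a + (1 + Real.log b / 2)) * ((b / √a) ^ t / t !) ^ 2 := by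
  have hb : 0 < b := by omega
  have ha' : (0 : ℝ) < a := by exact_mod_cast ha
  have hb' : (0 : ℝ) < b := by exact_mod_cast hb
  have ht' : (t : ℝ) ≤ b := by exact_mod_cast ht
  have hlog : 0 ≤ Real.log b := Real.log_natCast_nonneg b
  have h1 : (t : ℝ) * (logFactorialMean b - logFactorialMean a) ≤
      (1 + Real.log b / 2) + t * (Real.log b - Real.log a) := by
    have hLa : Real.log a - 1 ≤ logFactorialMean a := by
      rw [logFactorialMean, le_div_iff₀ ha']; linarith [le_log_factorial ha]
    have hLb : logFactorialMean b ≤ Real.log b - 1 + (1 + Real.log b / 2) / b := by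
      rw [logFactorialMean, div_le_iff₀ hb', add_mul, div_mul_cancel₀ _ hb'.ne']
      linarith [log_factorial_le hb]
    have h2 : (t : ℝ) * ((1 + Real.log b / 2) / b) ≤ 1 + Real.log b / 2 := by
      rw [mul_div_assoc', div_le_iff₀ hb', mul_comm]
      gcongr
    calc (t : ℝ) * (logFactorialMean b - logFactorialMean a)
        ≤ t * (Real.log b - 1 + (1 + Real.log b / 2) / b - (Real.log a - 1)) := by gcongr
      _ = t * ((1 + Real.log b / 2) / b) + t * (Real.log b - Real.log a) := by ring
      _ ≤ _ := by linarith
  have h3 : Real.exp (t * (Real.log b - Real.log a)) = (b / a) ^ t := by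
    rw [Real.exp_nat_mul, ← Real.log_div hb'.ne' ha'.ne', Real.exp_log (by positivity)]
  have h4 : (b.choose t : ℝ) ≤ b ^ t / t ! := Nat.choose_le_pow_div t b
  have hsq : (b : ℝ) * (b / a) = (b / √a) ^ 2 := by
    rw [div_pow, Real.sq_sqrt ha'.le]; ring
  calc (b.choose t : ℝ) *
        (Real.exp ((b - t) * logFactorialMean a + t * logFactorialMean b) / t !)
      ≤ (b ^ t / t !) * (Real.exp (b * logFactorialMean a + (1 + Real.log b / 2) +
          t * (Real.log b - Real.log a)) / t !) := by
        have h5 : (b - t) * logFactorialMean a + t * logFactorialMean b ≤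
            b * logFactorialMean a + (1 + Real.log b / 2) + t * (Real.log b - Real.log a) := by
          linarith
        have h6 := Real.exp_le_exp.2 h5
        gcongr
    _ = Real.exp (b * logFactorialMean a + (1 + Real.log b / 2)) *
          (((b : ℝ) * (b / a)) ^ t / (t ! * t !)) := by
        rw [Real.exp_add, h3, mul_pow]; ring
    _ = _ := by rw [hsq]; ring

variable {α β : Type*} [Fintype α] [Fintype β]

theorem card_relMatchings_le_exp {r : α → β → Prop} {a b : ℕ} (ha : 0 < a) (hab : a ≤ b)
    (hα : Fintype.card α = b) (hβ : Fintype.card β = b) (hr : ∀ x, relDegree r x = a) :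
    (#(relMatchings r) : ℝ) ≤ Real.exp (b * (Real.log a - 1) + 4 * (b / √a)) := by
  have hb' : (0 : ℝ) < b := by exact_mod_cast (by omega : 0 < b)
  refine (card_relMatchings_le_sum hα hβ hr).trans ?_
  refine (sum_le_sum fun t ht => choose_mul_exp_le (t := t) ha hab
    (by have := mem_range.1 ht; omega)).trans ?_
  rw [← mul_sum]
  calc _ ≤ Real.exp (b * logFactorialMean a + (1 + Real.log b / 2)) *
        Real.exp (2 * (b / √a)) := by
        gcongr
        exact sum_sq_pow_div_factorial_le (by positivity) _
    _ ≤ _ := by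
        rw [← Real.exp_add]
        apply Real.exp_le_exp.2
        linarith [mul_logFactorialMean_le ha b, one_add_half_log_le_sqrt hb',
          sqrt_le_div_sqrt ha hab]

theorem card_relEquivs_le_exp_div_sqrt {r : α → β → Prop} {a b : ℕ} (ha : 0 < a)
    (hα : Fintype.card α = b) (hr : ∀ x, relDegree r x = a) :
    (#(relEquivs r) : ℝ) ≤ Real.exp (b * (Real.log a - 1) + b / √a) := by
  refine (card_relEquivs_le_exp b r hα).trans (Real.exp_le_exp.2 ?_)
  simp only [hr]
  rw [sum_const, card_univ, hα, nsmul_eq_mul]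
  exact mul_logFactorialMean_le ha b

lemma card_relMatchings_pos (r : α → β → Prop) : 0 < #(relMatchings r) :=
  card_pos.2 ⟨fun _ => none, by simp⟩

lemma le_log_card_relMatchings {r : α → β → Prop} {a b : ℕ} (ha : 0 < a)
    (hα : Fintype.card α = b) (hβ : Fintype.card β = b) (hr : ∀ x, relDegree r x = a)
    (hr' : ∀ y, relDegree (fun y x => r x y) y = a) {t : ℕ} (ht0 : 0 < t) (ht : t < b) :
    b * (Real.log a - 1) + 2 * t * (1 + Real.log b - Real.log a / 2 - Real.log t) - t ^ 2 / b - 2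
      - Real.log t ≤ Real.log #(relMatchings r) := by
  have ha' : (0 : ℝ) < a := by exact_mod_cast ha
  have hb' : (0 : ℝ) < b := by exact_mod_cast (by omega : 0 < b)
  have htb : (t : ℝ) < b := by exact_mod_cast ht
  have ht1 : 0 < 1 - (t : ℝ) / b := by
    rw [sub_pos, div_lt_one hb']; exact htb
  have h := exp_neg_le_card_relMatchings ha (by omega) hα hβ hr hr' ht.le
  have hM : (0 : ℝ) < #(relMatchings r) := by exact_mod_cast card_relMatchings_pos r
  have h1 := Real.log_le_log (Real.exp_pos _) h
  have hp : 0 < (1 - (t : ℝ) / b) / a := by positivity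
  have hq : 0 < 1 / (b : ℝ) := by positivity
  have hf : (0 : ℝ) < t ! := by exact_mod_cast Nat.factorial_pos t
  rw [Real.log_exp, Real.log_mul (by positivity) (by positivity),
    Real.log_mul hM.ne' (by positivity), Real.log_mul hf.ne' hf.ne',
    Real.log_mul (by positivity) (by positivity), Real.log_pow, Real.log_pow,
    Real.log_div ht1.ne' ha'.ne', one_div, Real.log_inv, Nat.cast_sub ht.le] at h1
  push_cast at h1
  have h2 := Real.log_le_sub_one_of_pos ht1
  have h3 : ((b : ℝ) - t) * Real.log (1 - t / b) ≤ -t + t ^ 2 / b := by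
    calc ((b : ℝ) - t) * Real.log (1 - t / b) ≤ (b - t) * (-(t / b)) := by
          gcongr
          linarith
      _ = _ := by field_simp; ring
  have h4 := log_factorial_le ht0
  nlinarith

/-- The choice `t = ⌊b / (2√a)⌋` of the number of unmatched elements on each side. The exponent
`6 / 5` exceeds the exponent `1` in the upper bound for perfect matchings. -/
theorem exp_le_card_relMatchings {r : α → β → Prop} {a b : ℕ} (ha : 0 < a) (hab : a ≤ b)
    (hb : 2500 ≤ b) (hα : Fintype.card α = b) (hβ : Fintype.card β = b)
    (hr : ∀ x, relDegree r x = a) (hr' : ∀ y, relDegree (fun y x => r x y) y = a) :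
    Real.exp (b * (Real.log a - 1) + 6 / 5 * (b / √a)) ≤ #(relMatchings r) := by
  have ha' : (1 : ℝ) ≤ a := by exact_mod_cast ha
  have hb' : (2500 : ℝ) ≤ b := by exact_mod_cast hb
  have hs : 1 ≤ √(a : ℝ) := Real.one_le_sqrt.2 ha'
  set z : ℝ := b / √a with hz
  -- `50 = √2500 ≤ √b ≤ z` makes `z` large enough to absorb the lower-order terms.
  have hz50 : 50 ≤ z := by
    refine le_trans ?_ (sqrt_le_div_sqrt ha hab)
    rw [Real.le_sqrt (by norm_num) (by linarith)]
    linarith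
  have hzb : z ≤ b := div_le_self (by linarith) hs
  set t : ℕ := ⌊z / 2⌋₊ with ht
  have ht1 : (t : ℝ) ≤ z / 2 := Nat.floor_le (by linarith)
  have ht2 : z / 2 - 1 < t := by linarith [Nat.lt_floor_add_one (z / 2)]
  have ht0 : (0 : ℝ) < t := by linarith
  have htb : t < b := by
    have : (t : ℝ) < b := by linarith
    exact_mod_cast this
  have h := le_log_card_relMatchings ha hα hβ hr hr' (by exact_mod_cast ht0) htb
  have hlogz : Real.log z = Real.log b - Real.log a / 2 := by
    rw [hz, Real.log_div (by linarith) (by linarith), Real.log_sqrt (by linarith)]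
  have hlogzt : Real.log 2 + Real.log t ≤ Real.log z := by
    rw [← Real.log_mul (by norm_num) ht0.ne']
    exact Real.log_le_log (by positivity) (by linarith)
  have hlog2 := Real.log_two_gt_d9
  have h1 : 2 * (z / 2 - 1) * (169 / 100) ≤
      2 * t * (1 + Real.log b - Real.log a / 2 - Real.log t) := by
    have : 169 / 100 ≤ 1 + Real.log b - Real.log a / 2 - Real.log t := by linarith
    gcongr
  have h2 : (t : ℝ) ^ 2 / b ≤ z / 4 := by
    rw [div_le_iff₀ (by linarith)]
    nlinarith
  have h3 : Real.log t ≤ 2 + z / 16 := by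
    have h8 : Real.log 8 ≤ 3 := by
      rw [show (8 : ℝ) = 2 ^ 3 by norm_num, Real.log_pow]
      push_cast
      linarith [Real.log_two_lt_d9]
    have := Real.log_le_sub_one_of_pos (x := (t : ℝ) / 8) (by positivity)
    rw [Real.log_div ht0.ne' (by norm_num)] at this
    linarith
  rw [← Real.le_log_iff_exp_le (by exact_mod_cast card_relMatchings_pos r)]
  linarith

end Estimates

/-! ### Matchings of bipartite graphs as matchings of a relation -/

section Graphs

open Finset

variable {V : Type*} {G : SimpleGraph V} {X Y : Set V}

/-- The subgraph of a bipartite graph whose edges are given by a relation between the two classes,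
without isolated vertices. -/
def SimpleGraph.Subgraph.ofRel (P : X → Y → Prop) (hP : ∀ x y, P x y → G.Adj x y) :
    G.Subgraph where
  verts := {v | ∃ (x : X) (y : Y), P x y ∧ (v = x ∨ v = y)}
  Adj u v := ∃ (x : X) (y : Y), P x y ∧ (u = x ∧ v = y ∨ u = y ∧ v = x)
  adj_sub := by
    rintro u v ⟨x, y, h, ⟨rfl, rfl⟩ | ⟨rfl, rfl⟩⟩
    · exact hP x y h
    · exact (hP x y h).symm
  edge_vert := by
    rintro u v ⟨x, y, h, ⟨rfl, rfl⟩ | ⟨rfl, rfl⟩⟩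
    · exact ⟨x, y, h, Or.inl rfl⟩
    · exact ⟨x, y, h, Or.inr rfl⟩
  symm := ⟨by
    rintro u v ⟨x, y, h, ⟨rfl, rfl⟩ | ⟨rfl, rfl⟩⟩
    · exact ⟨x, y, h, Or.inr ⟨rfl, rfl⟩⟩
    · exact ⟨x, y, h, Or.inl ⟨rfl, rfl⟩⟩⟩

namespace SimpleGraph.Subgraph

lemma ofRel_adj (hXY : Disjoint X Y) {P : X → Y → Prop} (hP : ∀ x y, P x y → G.Adj x y)
    (x : X) (y : Y) : (ofRel P hP).Adj x y ↔ P x y := by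
  constructor
  · rintro ⟨x', y', h, ⟨h1, h2⟩ | ⟨h1, h2⟩⟩
    · rwa [Subtype.ext h1, Subtype.ext h2]
    · exact (Set.disjoint_left.1 hXY x.2 (h1 ▸ y'.2)).elim
  · intro h
    exact ⟨x, y, h, Or.inl ⟨rfl, rfl⟩⟩

lemma isMatching_ofRel (hXY : Disjoint X Y) {P : X → Y → Prop} (hP : ∀ x y, P x y → G.Adj x y)
    (h1 : ∀ x y y', P x y → P x y' → y = y') (h2 : ∀ x x' y, P x y → P x' y → x = x') :
    (ofRel P hP).IsMatching := by
  rintro v ⟨x, y, h, rfl | rfl⟩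
  · refine ⟨y, ⟨x, y, h, Or.inl ⟨rfl, rfl⟩⟩, ?_⟩
    rintro w ⟨x', y', h', ⟨h3, rfl⟩ | ⟨h3, rfl⟩⟩
    · obtain rfl := Subtype.ext h3
      rw [h1 _ _ _ h h']
    · exact (Set.disjoint_left.1 hXY x.2 (h3 ▸ y'.2)).elim
  · refine ⟨x, ⟨x, y, h, Or.inr ⟨rfl, rfl⟩⟩, ?_⟩
    rintro w ⟨x', y', h', ⟨h3, rfl⟩ | ⟨h3, rfl⟩⟩
    · exact (Set.disjoint_left.1 hXY x'.2 (h3 ▸ y.2)).elim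
    · obtain rfl := Subtype.ext h3
      rw [h2 _ _ _ h h']

lemma IsMatching.eq_ofRel (hG : G.IsBipartiteWith X Y) {M : G.Subgraph} (hM : M.IsMatching)
    {P : X → Y → Prop} (hP : ∀ x y, P x y → G.Adj x y) (h : ∀ x y, P x y ↔ M.Adj x y) :
    ofRel P hP = M := by
  have hadj : ∀ u v, (ofRel P hP).Adj u v ↔ M.Adj u v := by
    intro u v
    constructor
    · rintro ⟨x, y, hxy, ⟨rfl, rfl⟩ | ⟨rfl, rfl⟩⟩
      · exact (h x y).1 hxy
      · exact ((h x y).1 hxy).symm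
    · intro huv
      rcases hG.mem_of_adj huv.adj_sub with ⟨hu, hv⟩ | ⟨hu, hv⟩
      · exact ⟨⟨u, hu⟩, ⟨v, hv⟩, (h _ _).2 huv, Or.inl ⟨rfl, rfl⟩⟩
      · exact ⟨⟨v, hv⟩, ⟨u, hu⟩, (h _ _).2 huv.symm, Or.inr ⟨rfl, rfl⟩⟩
  refine Subgraph.ext ?_ (by ext u v; exact hadj u v)
  ext v
  constructor
  · rintro ⟨x, y, hxy, rfl | rfl⟩
    · exact M.edge_vert ((h x y).1 hxy)
    · exact M.edge_vert ((h x y).1 hxy).symm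
  · intro hv
    obtain ⟨w, hw, -⟩ := hM hv
    exact (ofRel P hP).edge_vert ((hadj v w).2 hw)

end SimpleGraph.Subgraph

open SimpleGraph SimpleGraph.Subgraph

/-- Matchings of a bipartite graph correspond to the matchings of the relation between its
classes. -/
theorem numMatchings_eq_card_relMatchings [Fintype X] [Fintype Y] (hG : G.IsBipartiteWith X Y) :
    numMatchings G = #(relMatchings fun (x : X) (y : Y) => G.Adj x y) := by
  classical
  have hP : ∀ f : relMatchings fun (x : X) (y : Y) => G.Adj x y,
      ∀ (x : X) (y : Y), f.1 x = some y → G.Adj x y := fun f => (mem_relMatchings.1 f.2).1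
  rw [numMatchings, ← Nat.card_eq_finsetCard]
  symm
  refine Nat.card_eq_of_bijective (fun f => (⟨ofRel (fun x y => f.1 x = some y) (hP f),
    isMatching_ofRel hG.disjoint _ (fun x y y' h h' => Option.some_injective _ (h.symm.trans h'))
      (mem_relMatchings.1 f.2).2⟩ : {M : G.Subgraph // M.IsMatching})) ⟨fun f g h => ?_, ?_⟩
  · have h' := congrArg Subtype.val h
    simp only at h'
    refine Subtype.ext (funext fun x => Option.ext fun y => ?_)
    rw [← ofRel_adj hG.disjoint (P := fun x y => f.1 x = some y) (hP f), h', ofRel_adj hG.disjoint]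
  · rintro ⟨M, hM⟩
    set f : X → Option Y := fun x => if h : ∃ y : Y, M.Adj x y then some h.choose else none with hf
    have hfM : ∀ (x : X) (y : Y), f x = some y ↔ M.Adj x y := by
      intro x y
      simp only [hf]
      split_ifs with h
      · rw [Option.some_inj]
        refine ⟨fun h' => h' ▸ h.choose_spec, fun h' => ?_⟩
        exact Subtype.ext ((hM (M.edge_vert h')).unique h.choose_spec h')
      · simpa using fun h' => h ⟨y, h'⟩
    refine ⟨⟨f, mem_relMatchings.2 ⟨fun x y h => ((hfM x y).1 h).adj_sub,
      fun x x' y h h' => ?_⟩⟩, Subtype.ext (hM.eq_ofRel hG (fun x y h => ((hfM x y).1 h).adj_sub) hfM)⟩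
    have h1 := ((hfM x y).1 h).symm
    exact Subtype.ext ((hM (M.edge_vert h1)).unique h1 ((hfM x' y).1 h').symm)

theorem numPerfectMatchings_eq_card_relEquivs [Fintype X] [Fintype Y]
    (hG : G.IsBipartiteWith X Y) (hXY : X ∪ Y = Set.univ) :
    numPerfectMatchings G = #(relEquivs fun (x : X) (y : Y) => G.Adj x y) := by
  have hP : ∀ σ : relEquivs fun (x : X) (y : Y) => G.Adj x y,
      ∀ (x : X) (y : Y), σ.1 x = y → G.Adj x y := fun σ x y h => h ▸ mem_relEquivs.1 σ.2 x
  rw [numPerfectMatchings, ← Nat.card_eq_finsetCard]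
  symm
  refine Nat.card_eq_of_bijective (fun σ => (⟨ofRel (fun x y => σ.1 x = y) (hP σ),
    isMatching_ofRel hG.disjoint _ (fun x y y' h h' => h.symm.trans h')
      (fun x x' y h h' => σ.1.injective (h.trans h'.symm)), fun v => ?_⟩ :
      {M : G.Subgraph // M.IsPerfectMatching})) ⟨fun σ τ h => ?_, ?_⟩
  · rcases (hXY ▸ Set.mem_univ v : v ∈ X ∪ Y) with hv | hv
    · exact ⟨⟨v, hv⟩, _, rfl, Or.inl rfl⟩
    · exact ⟨σ.1.symm ⟨v, hv⟩, ⟨v, hv⟩, σ.1.apply_symm_apply _, Or.inr rfl⟩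
  · have h' := congrArg Subtype.val h
    simp only at h'
    refine Subtype.ext (Equiv.ext fun x => ?_)
    rw [← ofRel_adj hG.disjoint (P := fun x y => σ.1 x = y) (hP σ), h', ofRel_adj hG.disjoint]
  · rintro ⟨M, hM, hspan⟩
    have hex : ∀ x : X, ∃ y : Y, M.Adj x y := fun x => by
      obtain ⟨w, hw, -⟩ := hM (hspan x)
      exact ⟨⟨w, (hG.mem_of_adj hw.adj_sub).elim And.right
        fun h => (Set.disjoint_left.1 hG.disjoint x.2 h.1).elim⟩, hw⟩
    have hex' : ∀ y : Y, ∃ x : X, M.Adj x y := fun y => by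
      obtain ⟨w, hw, -⟩ := hM (hspan y)
      exact ⟨⟨w, (hG.mem_of_adj hw.adj_sub).elim
        (fun h => (Set.disjoint_left.1 hG.disjoint h.1 y.2).elim) And.right⟩, hw.symm⟩
    choose g hg using hex
    choose g' hg' using hex'
    have huniq : ∀ {u v w : V}, M.Adj u v → M.Adj u w → v = w := fun h h' =>
      (hM (M.edge_vert h)).unique h h'
    have hgM : ∀ (x : X) (y : Y), g x = y ↔ M.Adj x y := fun x y =>
      ⟨fun h => h ▸ hg x, fun h => Subtype.ext (huniq (hg x) h)⟩
    exact ⟨⟨⟨g, g', fun x => Subtype.ext (huniq (hg' (g x)).symm (hg x).symm),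
      fun y => Subtype.ext (huniq (hg (g' y)) (hg' y))⟩,
      mem_relEquivs.2 fun x => (hg x).adj_sub⟩,
      Subtype.ext (hM.eq_ofRel hG (fun x y h => ((hgM x y).1 h).adj_sub) hgM)⟩

lemma relDegree_adj [Fintype V] [Fintype Y] [DecidableRel G.Adj] (hG : G.IsBipartiteWith X Y)
    (x : X) : relDegree (fun (x : X) (y : Y) => G.Adj x y) x = G.degree x := by
  classical
  rw [relDegree_eq_card, ← card_neighborFinset_eq_degree,
    ← card_map (Function.Embedding.subtype fun v => v ∈ Y)]
  congr 1
  ext v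
  simp only [mem_map, mem_filter, mem_univ, true_and, Function.Embedding.subtype_apply,
    Subtype.exists, exists_and_left, exists_prop, exists_eq_right_right, mem_neighborFinset]
  refine ⟨fun h => h.1, fun h => ⟨h, ?_⟩⟩
  rcases hG.mem_of_adj h with ⟨-, hv⟩ | ⟨hx, -⟩
  · exact hv
  · exact (Set.disjoint_left.1 hG.disjoint x.2 hx).elim

end Graphs

/-! ### Bounds for regular bipartite graphs -/

section Theta

open Finset

/-- The four inequalities for a regular bipartite graph: all quantities lie within explicit powers
of `exp (b / √a)` of `(a / e) ^ b`. -/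
theorem matching_bounds_of_regular {V : Type*} [Fintype V] {G : SimpleGraph V} [DecidableRel G.Adj]
    {X Y : Set V} {a b : ℕ} (ha : 1 ≤ a) (hb : 2500 ≤ b) (hG : G.IsBipartiteWith X Y)
    (hXY : X ∪ Y = Set.univ) (hX : X.ncard = b) (hY : Y.ncard = b)
    (hreg : G.IsRegularOfDegree a) :
    (numPerfectMatchings G : ℝ) * 2 ^ (1 / (5 * Real.log 2) * (b / √a)) ≤ numMatchings G ∧
    (numMatchings G : ℝ) ≤ numPerfectMatchings G * 2 ^ (4 / Real.log 2 * (b / √a)) ∧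
    ((a : ℝ) / Real.exp 1) ^ b * 2 ^ (1 / (5 * Real.log 2) * (b / √a)) ≤ numMatchings G ∧
    (numMatchings G : ℝ) ≤ ((a : ℝ) / Real.exp 1) ^ b * 2 ^ (4 / Real.log 2 * (b / √a)) := by
  classical
  have hα : Fintype.card X = b := by rw [← Nat.card_eq_fintype_card, Nat.card_coe_set_eq, hX]
  have hβ : Fintype.card Y = b := by rw [← Nat.card_eq_fintype_card, Nat.card_coe_set_eq, hY]
  have hr : ∀ x : X, relDegree (fun (x : X) (y : Y) => G.Adj x y) x = a := fun x => by
    rw [relDegree_adj hG, hreg x]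
  have hr' : ∀ y : Y, relDegree (fun (y : Y) (x : X) => G.Adj x y) y = a := fun y => by
    simp only [G.adj_comm]
    rw [relDegree_adj hG.symm, hreg y]
  have hab : a ≤ b := by
    obtain ⟨x⟩ : Nonempty X := Fintype.card_pos_iff.1 (by omega)
    rw [← hr x, ← hβ, relDegree_eq_card]
    exact card_le_univ _
  have ha' : (0 : ℝ) < a := by exact_mod_cast ha
  have hlog2 : 0 < Real.log 2 := Real.log_pos one_lt_two
  rw [numMatchings_eq_card_relMatchings hG, numPerfectMatchings_eq_card_relEquivs hG hXY]
  have h1 := pow_le_card_relEquivs ha hα hβ hr hr'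
  have h2 := card_relEquivs_le_exp_div_sqrt ha hα hr
  have h3 := card_relMatchings_le_exp ha hab hα hβ hr
  have h4 := exp_le_card_relMatchings ha hab hb hα hβ hr hr'
  set m : ℝ := (#(relEquivs fun (x : X) (y : Y) => G.Adj x y) : ℝ)
  set m' : ℝ := (#(relMatchings fun (x : X) (y : Y) => G.Adj x y) : ℝ)
  set z : ℝ := b / √a with hz
  have hz0 : 0 ≤ z := by positivity
  have hpow : ((a : ℝ) / Real.exp 1) ^ b = Real.exp (b * (Real.log a - 1)) := by
    rw [Real.exp_nat_mul, Real.exp_sub, Real.exp_log ha']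
  -- The constants `c = 1 / (5 log 2)` and `C = 4 / log 2` turn the powers of `2` into exponentials.
  have hc : (2 : ℝ) ^ (1 / (5 * Real.log 2) * z) = Real.exp (1 / 5 * z) := by
    rw [Real.rpow_def_of_pos two_pos]; congr 1; field_simp
  have hC : (2 : ℝ) ^ (4 / Real.log 2 * z) = Real.exp (4 * z) := by
    rw [Real.rpow_def_of_pos two_pos]; congr 1; field_simp
  rw [hpow] at h1 ⊢
  rw [hc, hC]
  rw [Real.exp_add] at h3
  refine ⟨?_, h3.trans (by gcongr), ?_, h3⟩
  · calc m * Real.exp (1 / 5 * z)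
        ≤ Real.exp (b * (Real.log a - 1) + z) * Real.exp (1 / 5 * z) := by gcongr
      _ = Real.exp (b * (Real.log a - 1) + 6 / 5 * z) := by rw [← Real.exp_add]; ring_nf
      _ ≤ m' := h4
  · refine le_trans ?_ h4
    rw [← Real.exp_add]
    exact Real.exp_le_exp.2 (by linarith)

end Theta

/-! ### The hypercube -/

section Hypercube

open Finset

instance (d : ℕ) : DecidableRel (hypercube d).Adj := fun x y =>
  inferInstanceAs (Decidable (hammingDist x y = 1))

/-- The vertex obtained from `x` by changing the coordinate `i`. -/
def flipCoord {d : ℕ} (x : Fin d → Bool) (i : Fin d) : Fin d → Bool :=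
  Function.update x i (!x i)

lemma hypercube_adj_iff {d : ℕ} {x y : Fin d → Bool} :
    (hypercube d).Adj x y ↔ ∃ i, y = flipCoord x i := by
  change hammingDist x y = 1 ↔ _
  rw [hammingDist, card_eq_one]
  refine exists_congr fun i => ⟨fun h => funext fun j => ?_, ?_⟩
  · have hj := Finset.ext_iff.1 h j
    simp only [mem_filter, mem_univ, true_and, mem_singleton] at hj
    by_cases hji : j = i
    · subst hji
      simpa [flipCoord, eq_comm, Bool.eq_not] using hj.2 rfl
    · simpa [flipCoord, hji, eq_comm] using hj
  · rintro rfl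
    ext j
    rw [mem_filter, mem_singleton]
    by_cases hji : j = i
    · subst hji; simp [flipCoord]
    · simp [flipCoord, hji]

lemma flipCoord_injective {d : ℕ} (x : Fin d → Bool) : Function.Injective (flipCoord x) := by
  intro i j h
  by_contra hij
  have := congrFun h i
  simp [flipCoord, hij] at this

lemma flipCoord_flipCoord {d : ℕ} (x : Fin d → Bool) (i : Fin d) :
    flipCoord (flipCoord x i) i = x := by
  simp [flipCoord]

lemma hypercube_isRegularOfDegree (d : ℕ) : (hypercube d).IsRegularOfDegree d := by
  intro x
  rw [← SimpleGraph.card_neighborFinset_eq_degree]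
  have : (hypercube d).neighborFinset x = univ.image (flipCoord x) := by
    ext y
    simp [hypercube_adj_iff, eq_comm]
  rw [this, card_image_of_injective _ (flipCoord_injective x), card_univ, Fintype.card_fin]

/-- The parity of the number of coordinates of `x` equal to `true`. -/
def cubeParity {d : ℕ} (x : Fin d → Bool) : ZMod 2 := ∑ i, if x i then 1 else 0

lemma cubeParity_flipCoord {d : ℕ} (x : Fin d → Bool) (i : Fin d) :
    cubeParity (flipCoord x i) = cubeParity x + 1 := by
  rw [cubeParity, cubeParity, ← add_sum_erase _ _ (mem_univ i), ← add_sum_erase _ _ (mem_univ i),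
    sum_congr rfl (g := fun j => if x j then (1 : ZMod 2) else 0) fun j hj => by
      simp [flipCoord, (mem_erase.1 hj).1]]
  have h2 : (1 : ZMod 2) + 1 = 0 := rfl
  rcases h : x i
  · simp [flipCoord, h, add_comm]
  · simp only [flipCoord, h, Function.update_self, Bool.not_true, Bool.false_eq_true, if_false,
      if_true]
    rw [add_right_comm, h2]

lemma cubeParity_ne_zero_iff {d : ℕ} {x : Fin d → Bool} : cubeParity x ≠ 0 ↔ cubeParity x = 1 := by
  generalize cubeParity x = p
  revert p
  decide

lemma hypercube_isBipartiteWith (d : ℕ) :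
    (hypercube d).IsBipartiteWith {x | cubeParity x = 0} {x | cubeParity x = 1} where
  disjoint := Set.disjoint_left.2 fun x (h0 : _ = _) (h1 : _ = _) => by
    rw [h0] at h1; exact absurd h1 (by decide)
  mem_of_adj x y h := by
    obtain ⟨i, rfl⟩ := hypercube_adj_iff.1 h
    simp only [Set.mem_ofPred_eq, cubeParity_flipCoord]
    generalize cubeParity x = p
    revert p
    decide

lemma ncard_cubeParity {d : ℕ} (hd : 1 ≤ d) :
    {x : Fin d → Bool | cubeParity x = 0}.ncard = 2 ^ (d - 1) ∧
      {x : Fin d → Bool | cubeParity x = 1}.ncard = 2 ^ (d - 1) := by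
  have heq : {x : Fin d → Bool | cubeParity x = 0}.ncard =
      {x : Fin d → Bool | cubeParity x = 1}.ncard := by
    refine Set.ncard_congr (fun x _ => flipCoord x ⟨0, hd⟩) (fun x hx => ?_)
      (fun x y _ _ h => ?_) (fun y hy => ⟨flipCoord y ⟨0, hd⟩, ?_, flipCoord_flipCoord _ _⟩)
    · change cubeParity x = 0 at hx
      change cubeParity _ = 1
      rw [cubeParity_flipCoord, hx, zero_add]
    · rw [← flipCoord_flipCoord x ⟨0, hd⟩, h, flipCoord_flipCoord]
    · change cubeParity y = 1 at hy
      change cubeParity _ = 0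
      rw [cubeParity_flipCoord, hy]
      rfl
  have hadd := Set.ncard_add_ncard_compl {x : Fin d → Bool | cubeParity x = 0}
  have hcompl : {x : Fin d → Bool | cubeParity x = 0}ᶜ = {x | cubeParity x = 1} := by
    ext x; exact cubeParity_ne_zero_iff
  rw [hcompl, Nat.card_eq_fintype_card, Fintype.card_fun, Fintype.card_bool, Fintype.card_fin]
    at hadd
  have hpow : 2 ^ d = 2 * 2 ^ (d - 1) := by rw [← pow_succ']; congr 1; omega
  omega

end Hypercube

/-! ### The asymptotic estimates -/


theorem proposition1p4 :
    -- regular bipartite graphs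
    (∃ c C : ℝ, 0 < c ∧ 0 < C ∧ ∃ b₀ : ℕ, ∀ a b : ℕ, 1 ≤ a → b₀ ≤ b →
      ∀ (V : Type*) [Fintype V] (G : SimpleGraph V) [DecidableRel G.Adj] (X Y : Set V),
        G.IsBipartiteWith X Y → X ∪ Y = Set.univ → X.ncard = b → Y.ncard = b →
        G.IsRegularOfDegree a →
          (numPerfectMatchings G : ℝ) * (2 : ℝ) ^ (c * ((b : ℝ) / √(a : ℝ)))
              ≤ (numMatchings G : ℝ) ∧
          (numMatchings G : ℝ)
              ≤ (numPerfectMatchings G : ℝ) * (2 : ℝ) ^ (C * ((b : ℝ) / √(a : ℝ))) ∧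
          ((a : ℝ) / Real.exp 1) ^ b * (2 : ℝ) ^ (c * ((b : ℝ) / √(a : ℝ)))
              ≤ (numMatchings G : ℝ) ∧
          (numMatchings G : ℝ)
              ≤ ((a : ℝ) / Real.exp 1) ^ b * (2 : ℝ) ^ (C * ((b : ℝ) / √(a : ℝ)))) ∧
    -- hypercubes
    (∃ c C : ℝ, 0 < c ∧ 0 < C ∧ ∃ d₀ : ℕ, ∀ d n : ℕ, 1 ≤ d → d₀ ≤ d → n = 2 ^ (d - 1) →
      (numPerfectMatchings (hypercube d) : ℝ) * (2 : ℝ) ^ (c * ((n : ℝ) / √(d : ℝ)))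
          ≤ (numMatchings (hypercube d) : ℝ) ∧
      (numMatchings (hypercube d) : ℝ)
          ≤ (numPerfectMatchings (hypercube d) : ℝ) * (2 : ℝ) ^ (C * ((n : ℝ) / √(d : ℝ))) ∧
      ((d : ℝ) / Real.exp 1) ^ n * (2 : ℝ) ^ (c * ((n : ℝ) / √(d : ℝ)))
          ≤ (numMatchings (hypercube d) : ℝ) ∧
      (numMatchings (hypercube d) : ℝ)
          ≤ ((d : ℝ) / Real.exp 1) ^ n * (2 : ℝ) ^ (C * ((n : ℝ) / √(d : ℝ)))) := by
  have hlog2 : 0 < Real.log 2 := Real.log_pos one_lt_two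
  refine ⟨⟨1 / (5 * Real.log 2), 4 / Real.log 2, by positivity, by positivity, 2500, ?_⟩,
    ⟨1 / (5 * Real.log 2), 4 / Real.log 2, by positivity, by positivity, 13, ?_⟩⟩
  · intro a b ha hb V _ G _ X Y hG hXY hX hY hreg
    exact matching_bounds_of_regular ha hb hG hXY hX hY hreg
  · rintro d n hd hd₀ rfl
    -- `d ≥ 13` ensures `2 ^ (d - 1) ≥ 2 ^ 12 = 4096 ≥ 2500`.
    have hn : 2500 ≤ 2 ^ (d - 1) :=
      le_trans (by norm_num) (Nat.pow_le_pow_right two_pos (by omega : 12 ≤ d - 1))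
    refine matching_bounds_of_regular hd hn (hypercube_isBipartiteWith d) ?_
      (ncard_cubeParity hd).1 (ncard_cubeParity hd).2 (hypercube_isRegularOfDegree d)
    ext x
    simp only [Set.mem_union, Set.mem_ofPred_eq, Set.mem_univ, iff_true]
    exact (em (cubeParity x = 0)).imp_right cubeParity_ne_zero_iff.1
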